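/- Let $B$ be a unital $*$-algebra over $\mathbb{C}$ and let $(A,\mathcal{E})$ be a $B$-valued $*$-noncommutative probability space: $A$ is a unital $*$-algebra over $\mathbb C$ containing a unital copy of $B$, and $\mathcal{E}:A\to B$ is a linear, $*$-preserving map which is the identity on $B$ and satisfies $\mathcal{E}(b_1xb_2)=b_1\mathcal{E}(x)b_2$ for $x\in A$, $b_1,b_2\in B$. Let $a\in A$ be $B$-valued R-diagonal, that is, $\mathcal{E}(ab_1a^*b_2a\cdots a^*b_{2k}a)=0$ for all $k\ge0$ and $b_1,\dots,b_{2k}\in B$, and for all $n\ge1$, $\epsilon\in\{1,*\}^n$ and $b_1,\dots,b_n\in B$ $$\mathcal{E}\Big(\prod_{V\in\sigma(\epsilon)}\Big(\prod_{j\in V}a^{\epsilon(j)}b_j-\mathcal{E}\Big(\prod_{j\in V}a^{\epsilon(j)}b_j\Big)\Big)\Big)=0,$$ where $\sigma(\epsilon)$ is the partition of $\{1,\dots,n\}$ into the maximal intervals on which $\epsilon$ alternates, and products are taken in increasing order. Put $a_1=a$, $a_2=a^*$. The cumulant maps $\alpha_j:B^{n-1}\to B$, $j\in\{1,2\}^n$,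 $n\ge1$, are the $\mathbb{C}$-multilinear maps determined recursively by the moment-cumulant formula $\mathcal{E}(a_{j(1)}b_1a_{j(2)}\cdots b_{n-1}a_{j(n)})=\sum_{\pi}\hat\alpha_j(\pi)[b_1,\dots,b_{n-1}]$, the sum being over all noncrossing partitions $\pi$ of $\{1,\dots,n\}$, where $\hat\alpha_j(\pi)$ is obtained by successively replacing in the word an interval block $\{p,\dots,p+q-1\}$, i.e. the factor $a_{j(p)}b_p\cdots b_{p+q-2}a_{j(p+q-1)}$, by $\alpha_{(j(p),\dots,j(p+q-1))}(b_p,\dots,b_{p+q-2})$. For $\ell\ge1$ let $\alpha^{(1)}_\ell=\alpha_{(1,2,1,2,\dots,1,2)}$ and $\alpha^{(2)}_\ell=\alpha_{(2,1,2,1,\dots,2,1)}$ be the cumulant maps for the alternating sequences of length $2\ell$. (1) For $b_1,b_2\in B$ consider the formal series $$F(b_1,b_2)=\sum_{n\ge0}\mathcal{E}\big((ab_1a^*b_2)^n\big),\qquad G(b_1,b_2)=\sum_{n\ge0}\mathcal{E}\big((a^*b_1ab_2)^n\big),$$ in which $b_1$ and $b_2$ are each given degree one, so that the $n$-th terms have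 degree $2n$. Then $$F(b_1,b_2)=1+\sum_{\ell\ge1}\alpha^{(1)}_\ell\big(b_1G(b_2,b_1),\,b_2F(b_1,b_2),\,b_1G(b_2,b_1),\dots,b_2F(b_1,b_2),\,b_1G(b_2,b_1)\big)\,b_2F(b_1,b_2),$$ $$G(b_1,b_2)=1+\sum_{\ell\ge1}\alpha^{(2)}_\ell\big(b_1F(b_2,b_1),\,b_2G(b_1,b_2),\,b_1F(b_2,b_1),\dots,b_2G(b_1,b_2),\,b_1F(b_2,b_1)\big)\,b_2G(b_1,b_2),$$ where the right-hand sides are expanded formally; in each degree only finitely many $\ell$ contribute, and equality holds in each degree. (2) More generally, these identities hold for multilinear function series, i.e. families $X=(\chi_n)_{n\ge0}$ of $\mathbb C$-multilinear maps $\chi_n:B^n\to B$ (with $\chi_0\in B$), with termwise addition, with unit $1$ the series with constant term $1$ and no other terms, with product $(X\Psi)_n(b_1,\dots,b_n)=\sum_{k=0}^n\chi_k(b_1,\dots,b_k)\psi_{n-k}(b_{k+1},\dots,b_n)$, and with the multivariate composition $X\overset{f}{\circ}(\Psi^{(1)},\Psi^{(2)})$ that substitutes $\Psi^{(f(p,t))}$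 (without constant term) for the $t$-th argument of $\chi_p$ and expands multilinearly. Let $I$ be the series whose only nonzero term is the identity map in degree $1$; let $M^{(1)}$ and $M^{(2)}$ have constant term $1$, vanishing odd terms, and terms of degree $2n$ given by $\mathcal{E}(ab_1a^*b_2\cdots ab_{2n-1}a^*b_{2n})$ and $\mathcal{E}(a^*b_1ab_2\cdots a^*b_{2n-1}ab_{2n})$ respectively; let $A^{(i)}$ have vanishing even terms and term $\alpha^{(i)}_\ell$ in degree $2\ell-1$. Then $$M^{(1)}=1+\big(A^{(1)}\overset{f}{\circ}(IM^{(1)},IM^{(2)})\big)\,IM^{(1)},\qquad M^{(2)}=1+\big(A^{(2)}\overset{g}{\circ}(IM^{(1)},IM^{(2)})\big)\,IM^{(2)},$$ where $f(p,t),g(p,t)\in\{1,2\}$, $f(p,t)\equiv t+1$ and $g(p,t)\equiv t$ modulo $2$. -/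

import Mathlib

open scoped BigOperators

noncomputable section

/-! ## Algebra-valued `*`-noncommutative probability spaces -/

/-- A `B`-valued `*`-noncommutative probability space `(A, E)`: a unital `*`-algebra `A` containing a
unital copy `incl B` of `B`, and a `*`-preserving conditional expectation `E : A → B`. -/
structure StarProbSpace (B A : Type*) [Ring B] [StarRing B] [Algebra ℂ B] [StarModule ℂ B]
    [Ring A] [StarRing A] [Algebra ℂ A] [StarModule ℂ A] where
  incl : B →⋆ₐ[ℂ] A
  E : A →ₗ[ℂ] B
  E_incl : ∀ b : B, E (incl b) = b
  E_bimod : ∀ (b₁ b₂ : B) (x : A), E (incl b₁ * x * incl b₂) = b₁ * E x * b₂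
  E_star : ∀ x : A, E (star x) = star (E x)

/-! ## Noncrossing partitions and nested evaluation of cumulants -/

/-- A partition of `{0, …, n-1}` is noncrossing if there are no `p < q < r < s` with `p, r` in one
block and `q, s` in another block. -/
def IsNoncrossing {n : ℕ} (π : Finpartition (Finset.univ : Finset (Fin n))) : Prop :=
  ∀ p q r s : Fin n, p < q → q < r → r < s →
    π.part p = π.part r → π.part q = π.part s → π.part p = π.part q

/-- For a block `V = {v₀ < v₁ < ⋯ < v_k}` of positions in the word
`c₀ x₁ c₁ x₂ c₂ ⋯ x_n c_n` (position `v : Fin n` has the coefficient `c v.castSucc` on its left and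
the coefficient `c v.succ` on its right), the element `α_{j|V}(c_{v₀}, …, c_{v_{k-1}}) c_{v_k}` of
`B`, where `c_v` stands for the coefficient on the right of position `v`.  Here `α k j'` is a map in
`k` arguments attached to the index sequence `j'` of length `k + 1`. -/
def blockValue {I B : Type*} [Ring B] (α : (k : ℕ) → (Fin (k + 1) → I) → (Fin k → B) → B)
    {n : ℕ} (j : Fin n → I) (V : Finset (Fin n)) (c : Fin (n + 1) → B) : B :=
  if h : V.card = (V.card - 1) + 1 then
    α (V.card - 1) (fun i => j (V.orderEmbOfFin h i))
      (fun i => c (V.orderEmbOfFin h i.castSucc).succ) *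
      c (V.orderEmbOfFin h (Fin.last _)).succ
  else 1

/-- Removal of the block `V`, whose least position is `s`, from the word `c₀ x₁ c₁ ⋯ x_n c_n`:
its value is multiplied into the coefficient on the left of `s`. -/
def absorbBlock {I B : Type*} [Ring B] (α : (k : ℕ) → (Fin (k + 1) → I) → (Fin k → B) → B)
    {n : ℕ} (j : Fin n → I) (V : Finset (Fin n)) (s : Fin n) (c : Fin (n + 1) → B) :
    Fin (n + 1) → B :=
  Function.update c s.castSucc (c s.castSucc * blockValue α j V c)

/-- The coefficients of the word obtained from `c₀ x₁ c₁ ⋯ x_n c_n` by removing successively those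
blocks of `π` whose least position belongs to the list `l` (the last entry of `l` first). -/
def absorbBlocks {I B : Type*} [Ring B] (α : (k : ℕ) → (Fin (k + 1) → I) → (Fin k → B) → B)
    {n : ℕ} (j : Fin n → I) (π : Finpartition (Finset.univ : Finset (Fin n)))
    (l : List (Fin n)) (c : Fin (n + 1) → B) : Fin (n + 1) → B :=
  l.foldr (fun s c' => if ∀ t ∈ π.part s, s ≤ t then absorbBlock α j (π.part s) s c' else c') c

/-- The map `α̂_j(π)[b₁, …, b_m]` for `n = m + 1`.  Repeatedly remove an interval block
`{p, …, p+q-1}` from the word `1 x₁ b₁ x₂ ⋯ b_m x_{m+1} 1`, replacing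
`b_{p-1} x_p b_p ⋯ x_{p+q-1} b_{p+q-1}` by `b_{p-1} α(b_p, …, b_{p+q-2}) b_{p+q-1}`, until one
coefficient is left.  The block that is removed is always the one with the largest least element;
among the blocks that are still present it is an interval block because `π` is noncrossing, and all
the positions to the left of it are still present.  The two outer coefficients `1` make the cases of
a block at the left or at the right end of the word special cases of the general one. -/
def nestedValue {I B : Type*} [Ring B] (α : (k : ℕ) → (Fin (k + 1) → I) → (Fin k → B) → B)
    {m : ℕ} (j : Fin (m + 1) → I) (π : Finpartition (Finset.univ : Finset (Fin (m + 1))))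
    (b : Fin m → B) : B :=
  absorbBlocks α j π (List.finRange (m + 1)) (Fin.cons 1 (Fin.snoc b 1)) 0

/-! ## Multilinearity of the nested evaluation -/

/-- A function of `m` arguments is `ℂ`-multilinear. -/
def IsMultilin {B : Type*} [Ring B] [Algebra ℂ B] {m : ℕ} (f : (Fin m → B) → B) : Prop :=
  ∀ (b : Fin m → B) (i : Fin m) (r : ℂ) (x y : B),
    f (Function.update b i (r • x + y)) =
      r • f (Function.update b i x) + f (Function.update b i y)

theorem update_comp_inj {S : Type*} {p q : ℕ} {e : Fin p → Fin q} (he : Function.Injective e) (c : Fin q → S)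
    (i : Fin p) (x : S) :
    (fun t => Function.update c (e i) x (e t)) = Function.update (fun t => c (e t)) i x := by
  funext t
  by_cases h : t = i
  · subst h; simp
  · simp [h, he.ne h]

theorem update_comp_not_mem {S : Type*} {p q : ℕ} {e : Fin p → Fin q} (c : Fin q → S)
    (i : Fin q) (hi : ∀ t, e t ≠ i) (x : S) :
    (fun t => Function.update c i x (e t)) = (fun t => c (e t)) := by
  funext t
  simp [hi t]

theorem blockValue_update_of_notMem {I B : Type*} [Ring B]
    (α : (k : ℕ) → (Fin (k + 1) → I) → (Fin k → B) → B)
    {n : ℕ} (j : Fin n → I) (V : Finset (Fin n)) (c : Fin (n + 1) → B) (i : Fin (n + 1))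
    (hi : ∀ v ∈ V, v.succ ≠ i) (x : B) :
    blockValue α j V (Function.update c i x) = blockValue α j V c := by
  unfold blockValue
  split_ifs with h
  · have h1 : ∀ t, (V.orderEmbOfFin h t).succ ≠ i := fun t =>
      hi _ (V.orderEmbOfFin_mem h t)
    congr 2
    · funext t; simp [h1]
    · simp [h1]
  · rfl

section Multilin

variable {I B : Type*} [Ring B] [Algebra ℂ B]

/-- A multilinear function, bundled. -/
def IsMultilin.toMultilinearMap {m : ℕ} {f : (Fin m → B) → B} (hf : IsMultilin f) :
    MultilinearMap ℂ (fun _ : Fin m => B) B :=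
  MultilinearMap.mk' f
    (fun b i x y => by simpa using hf b i 1 x y)
    (fun b i r x => by
      have h0 : f (Function.update b i 0) = 0 := by
        have := hf b i 1 0 0
        simpa using this
      have := hf b i r x 0
      simpa [h0] using this)

theorem MultilinearMap.isMultilin {m : ℕ} (f : MultilinearMap ℂ (fun _ : Fin m => B) B) :
    IsMultilin f := by
  intro b i r x y
  rw [f.map_update_add, f.map_update_smul]

theorem blockValue_update_add (α : (k : ℕ) → (Fin (k + 1) → I) → (Fin k → B) → B)
    (hα : ∀ k j, IsMultilin (α k j))
    {n : ℕ} (j : Fin n → I) (V : Finset (Fin n)) (c : Fin (n + 1) → B) (v : Fin n)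
    (hv : v ∈ V) (r : ℂ) (x y : B) :
    blockValue α j V (Function.update c v.succ (r • x + y)) =
      r • blockValue α j V (Function.update c v.succ x) +
        blockValue α j V (Function.update c v.succ y) := by
  have h : V.card = (V.card - 1) + 1 := by
    have := Finset.card_pos.2 ⟨v, hv⟩
    omega
  unfold blockValue
  simp only [dif_pos h]
  obtain ⟨t, rfl⟩ : ∃ t, V.orderEmbOfFin h t = v := by
    have := V.range_orderEmbOfFin h
    have hv' : v ∈ Set.range (V.orderEmbOfFin h) := by rw [this]; exact hv
    exact hv'
  have inj : Function.Injective (fun t => (V.orderEmbOfFin h t).succ) :=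
    (Fin.succ_injective _).comp (V.orderEmbOfFin h).injective
  induction t using Fin.lastCases with
  | last =>
    have h1 : ∀ t, (V.orderEmbOfFin h (Fin.castSucc t)).succ
        ≠ (V.orderEmbOfFin h (Fin.last _)).succ := fun t e =>
      (Fin.castSucc_lt_last t).ne (inj e)
    simp only [Function.update_self]
    simp only [Function.update_of_ne (h1 _)]
    rw [mul_add, mul_smul_comm]
  | cast t =>
    have h1 : (V.orderEmbOfFin h (Fin.last _)).succ
        ≠ (V.orderEmbOfFin h (Fin.castSucc t)).succ := fun e =>
      (Fin.castSucc_lt_last t).ne' (inj e)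
    have inj2 : Function.Injective
        (fun t : Fin (V.card - 1) => (V.orderEmbOfFin h (Fin.castSucc t)).succ) :=
      fun a b e => Fin.castSucc_injective _ (inj e)
    simp only [Function.update_of_ne h1]
    have key := fun z => update_comp_inj inj2 c t z
    simp only [key]
    rw [hα, add_mul, smul_mul_assoc]

/-- When the blocks with least position `< s` are still to be removed, the result does not depend on
the coefficients that have been used up, and depends linearly on each of the others. -/
theorem absorbBlocks_multilin (α : (k : ℕ) → (Fin (k + 1) → I) → (Fin k → B) → B)
    (hα : ∀ k j, IsMultilin (α k j)) {m : ℕ} (j : Fin (m + 1) → I)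
    (π : Finpartition (Finset.univ : Finset (Fin (m + 1)))) (s : ℕ) (hs : s ≤ m + 1) :
    (∀ (c : Fin (m + 2) → B) (v : Fin (m + 1)), (∀ t ∈ π.part v, s ≤ t.1) → ∀ x : B,
      absorbBlocks α j π ((List.finRange (m + 1)).take s) (Function.update c v.succ x) 0 =
        absorbBlocks α j π ((List.finRange (m + 1)).take s) c 0) ∧
    (∀ (c : Fin (m + 2) → B) (i : Fin (m + 2)),
      (i = 0 ∨ ∃ v : Fin (m + 1), v.succ = i ∧ ∃ t ∈ π.part v, t.1 < s) → ∀ (r : ℂ) (x y : B),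
      absorbBlocks α j π ((List.finRange (m + 1)).take s) (Function.update c i (r • x + y)) 0 =
        r • absorbBlocks α j π ((List.finRange (m + 1)).take s) (Function.update c i x) 0 +
          absorbBlocks α j π ((List.finRange (m + 1)).take s) (Function.update c i y) 0) := by
  induction s with
  | zero =>
    refine ⟨?_, ?_⟩
    · intro c v _ x
      simp only [List.take_zero, absorbBlocks, List.foldr_nil]
      exact Function.update_of_ne (Fin.succ_ne_zero v).symm _ _
    · rintro c i (rfl | ⟨v, _, t, _, ht⟩) r x y
      · simp [absorbBlocks]
      · omega
  | succ s ih =>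
    obtain ⟨ih1, ih2⟩ := ih (by omega)
    have hs' : s < m + 1 := hs
    set p : Fin (m + 1) := ⟨s, hs'⟩ with hp
    have htake : (List.finRange (m + 1)).take (s + 1) = (List.finRange (m + 1)).take s ++ [p] := by
      rw [List.take_add_one]
      simp [hs', hp]
    have step : ∀ c : Fin (m + 2) → B,
        absorbBlocks α j π ((List.finRange (m + 1)).take (s + 1)) c =
        absorbBlocks α j π ((List.finRange (m + 1)).take s)
          (if ∀ t ∈ π.part p, p ≤ t then absorbBlock α j (π.part p) p c else c) := by
      intro c
      rw [htake]
      simp [absorbBlocks, List.foldr_append]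
    have pmem : p ∈ π.part p := π.mem_part (Finset.mem_univ _)
    have part_eq : ∀ {v w : Fin (m + 1)}, v ∈ π.part w → π.part v = π.part w := fun {v w} h =>
      π.part_eq_of_mem (π.part_mem.2 (Finset.mem_univ _)) h
    by_cases hmin : ∀ t ∈ π.part p, p ≤ t
    · have step' : ∀ c : Fin (m + 2) → B,
          absorbBlocks α j π ((List.finRange (m + 1)).take (s + 1)) c =
          absorbBlocks α j π ((List.finRange (m + 1)).take s)
            (absorbBlock α j (π.part p) p c) := fun c => by rw [step, if_pos hmin]
      -- the coefficient on the left of `p` is not one of those on the right of the block of `p`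
      have hleft : ∀ v ∈ π.part p, v.succ ≠ p.castSucc := by
        intro v hv e
        have h1 := hmin v hv
        have h2 : (v : ℕ) + 1 = p := by simpa using congrArg Fin.val e
        have h3 : (p : ℕ) ≤ v := h1
        omega
      have halive : p.castSucc = 0 ∨
          ∃ v : Fin (m + 1), v.succ = p.castSucc ∧ ∃ t ∈ π.part v, t.1 < s := by
        rcases Nat.eq_zero_or_pos s with h0 | h0
        · left; ext; simp [hp, h0]
        · right
          refine ⟨⟨s - 1, by omega⟩, ?_, ⟨s - 1, by omega⟩, π.mem_part (Finset.mem_univ _), ?_⟩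
          · ext; simp [hp]; omega
          · simp; omega
      refine ⟨?_, ?_⟩
      · intro c v hv x
        rw [step', step']
        have hvp : ∀ w ∈ π.part p, w.succ ≠ v.succ := by
          intro w hw e
          have e' : w = v := Fin.succ_injective _ e
          subst e'
          have := hv p (by rw [part_eq hw]; exact pmem)
          simp [hp] at this
        have hne : p.castSucc ≠ v.succ := by
          intro e
          have h2 : (p : ℕ) = v + 1 := by simpa using congrArg Fin.val e
          have := hv v (π.mem_part (Finset.mem_univ _))
          simp [hp] at h2
          omega
        unfold absorbBlock
        rw [blockValue_update_of_notMem α j _ c _ hvp, Function.update_of_ne hne,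
          Function.update_comm hne.symm, ih1 _ v (fun t ht => (Nat.le_succ s).trans (hv t ht))]
      · intro c i hi r x y
        simp only [step']
        unfold absorbBlock
        by_cases hmem : ∃ v ∈ π.part p, v.succ = i
        · obtain ⟨v, hv, rfl⟩ := hmem
          have hne := hleft v hv
          have hdead : ∀ t ∈ π.part v, s ≤ t.1 := by
            intro t ht
            rw [part_eq hv] at ht
            exact hmin t ht
          simp only [Function.update_of_ne hne.symm]
          rw [blockValue_update_add α hα j _ c v hv]
          simp only [fun a b : B => Function.update_comm hne a b c]
          simp only [ih1 _ v hdead]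
          rw [mul_add, mul_smul_comm]
          exact ih2 c _ halive _ _ _
        · have hnot : ∀ v ∈ π.part p, v.succ ≠ i := fun v hv e => hmem ⟨v, hv, e⟩
          simp only [blockValue_update_of_notMem α j _ c _ hnot]
          by_cases hip : i = p.castSucc
          · subst hip
            simp only [Function.update_self, Function.update_idem]
            rw [add_mul, smul_mul_assoc]
            exact ih2 c _ halive _ _ _
          · simp only [Function.update_of_ne (Ne.symm hip), Function.update_comm hip]
            refine ih2 _ i ?_ r x y
            rcases hi with h0 | ⟨v, hv, t, ht, hts⟩
            · exact Or.inl h0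
            · refine Or.inr ⟨v, hv, t, ht, ?_⟩
              rcases Nat.lt_succ_iff_lt_or_eq.1 hts with h | h
              · exact h
              · exfalso
                have htp : t = p := Fin.ext h
                subst htp
                exact hnot v (by rw [part_eq ht]; exact π.mem_part (Finset.mem_univ _)) hv
    · have step' : ∀ c : Fin (m + 2) → B,
          absorbBlocks α j π ((List.finRange (m + 1)).take (s + 1)) c =
          absorbBlocks α j π ((List.finRange (m + 1)).take s) c := fun c => by
        rw [step, if_neg hmin]
      refine ⟨?_, ?_⟩
      · intro c v hv x
        rw [step', step']
        exact ih1 c v (fun t ht => (Nat.le_succ s).trans (hv t ht)) x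
      · intro c i hi r x y
        simp only [step']
        refine ih2 c i ?_ r x y
        rcases hi with h0 | ⟨v, hv, t, ht, hts⟩
        · exact Or.inl h0
        · refine Or.inr ⟨v, hv, ?_⟩
          rcases Nat.lt_succ_iff_lt_or_eq.1 hts with h | h
          · exact ⟨t, ht, h⟩
          · have htp : t = p := Fin.ext h
            rw [htp] at ht
            push Not at hmin
            obtain ⟨u, hu, hup⟩ := hmin
            refine ⟨u, ?_, hup⟩
            rw [← part_eq ht]
            exact hu

theorem nestedValue_multilin (α : (k : ℕ) → (Fin (k + 1) → I) → (Fin k → B) → B)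
    (hα : ∀ k j, IsMultilin (α k j)) {m : ℕ} (j : Fin (m + 1) → I)
    (π : Finpartition (Finset.univ : Finset (Fin (m + 1)))) :
    IsMultilin (nestedValue α j π) := by
  intro b i r x y
  have key : ∀ z : B, (Fin.cons 1 (Fin.snoc (Function.update b i z) 1 : Fin (m + 1) → B) :
      Fin (m + 2) → B) = Function.update (Fin.cons 1 (Fin.snoc b 1 : Fin (m + 1) → B))
        i.castSucc.succ z := by
    intro z
    rw [Fin.snoc_update, Fin.cons_update]
  have h := (absorbBlocks_multilin α hα j π (m + 1) le_rfl).2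
    (Fin.cons 1 (Fin.snoc b 1 : Fin (m + 1) → B)) i.castSucc.succ
    (Or.inr ⟨i.castSucc, rfl, i.castSucc, π.mem_part (Finset.mem_univ _), i.castSucc.2⟩) r x y
  have ht : (List.finRange (m + 1)).take (m + 1) = List.finRange (m + 1) := by
    rw [List.take_of_length_le]; simp
  rw [ht] at h
  unfold nestedValue
  rw [key, key, key]
  exact h

end Multilin

/-! ## Moments, cumulants and R-diagonality -/

namespace StarProbSpace

variable {B A : Type*} [Ring B] [StarRing B] [Algebra ℂ B] [StarModule ℂ B]
    [Ring A] [StarRing A] [Algebra ℂ A] [StarModule ℂ A] (P : StarProbSpace B A)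

/-- The multilinear map `(b₁, …, b_n) ↦ x₁ b₁ x₂ b₂ ⋯ x_n b_n` from `Bⁿ` to `A`. -/
def word {n : ℕ} (x : Fin n → A) : MultilinearMap ℂ (fun _ : Fin n => B) A :=
  (MultilinearMap.mkPiAlgebraFin ℂ n A).compLinearMap
    (fun i => (LinearMap.mulLeft ℂ (x i)).comp P.incl.toAlgHom.toLinearMap)

/-- The moment map `ψ(b₁, …, b_m) = E(x₁ b₁ x₂ b₂ ⋯ x_m b_m x_{m+1})`. -/
def moment {m : ℕ} (x : Fin (m + 1) → A) : MultilinearMap ℂ (fun _ : Fin m => B) B :=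
  (P.E.comp (LinearMap.mulRight ℂ (x (Fin.last m)))).compMultilinearMap
    (P.word fun i : Fin m => x i.castSucc)

open Classical in
/-- The cumulant `α_j(b₁, …, b_m)` of the family `x`, for a sequence `j` of length `m + 1`, defined
recursively by the moment-cumulant formula
`E(x_{j(1)} b₁ x_{j(2)} ⋯ b_m x_{j(m+1)}) = ∑_{π ∈ NC(m+1)} α̂_j(π)[b₁, …, b_m]`,
in which the term for the one-block partition is `α_j(b₁, …, b_m)` and the other terms contain only
cumulants of shorter sequences. -/
def cumulantFun {I : Type*} (x : I → A) : (m : ℕ) → (Fin (m + 1) → I) → (Fin m → B) → B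
  | m, j, b => P.moment (fun i => x (j i)) b -
      ∑ π : Finpartition (Finset.univ : Finset (Fin (m + 1))) with IsNoncrossing π ∧ π ≠ ⊤,
        nestedValue (fun k j' b' => if _h : k < m then cumulantFun x k j' b' else 0) j π b
termination_by m => m

theorem cumulantFun_multilin {I : Type*} (x : I → A) (m : ℕ) (j : Fin (m + 1) → I) :
    IsMultilin (P.cumulantFun x m j) := by
  induction m using Nat.strong_induction_on with
  | _ m ih =>
    have hα : ∀ k (j' : Fin (k + 1) → I), IsMultilin
        (fun b' => if _h : k < m then P.cumulantFun x k j' b' else 0) := by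
      intro k j'
      by_cases h : k < m
      · simpa [h] using ih k h j'
      · intro b i r u v
        simp [h]
    intro b i r u v
    simp only [cumulantFun.eq_def P x m]
    rw [(P.moment _).isMultilin b i r u v]
    rw [Finset.sum_congr rfl fun π _ => nestedValue_multilin _ hα j π b i r u v]
    rw [Finset.sum_add_distrib, ← Finset.smul_sum, smul_sub]
    abel

/-- The cumulant map `α_j : B^m → B` of the family `x`, for a sequence `j` of length `m + 1`. -/
def cumulant {I : Type*} (x : I → A) (m : ℕ) (j : Fin (m + 1) → I) :
    MultilinearMap ℂ (fun _ : Fin m => B) B :=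
  (P.cumulantFun_multilin x m j).toMultilinearMap

end StarProbSpace

/-- The pair `(a, a*)`; the indices `0, 1 : Fin 2` stand for the symbols `1, *` (or `1, 2`). -/
def starPair {A : Type*} [Star A] (a : A) : Fin 2 → A := ![a, star a]

/-- The `k`-th term (from `k = 0`) of the alternating sequence in `Fin 2` that starts with `i`. -/
def altIdx (i : Fin 2) (k : ℕ) : Fin 2 := i + Fin.ofNat 2 k

namespace StarProbSpace

variable {B A : Type*} [Ring B] [StarRing B] [Algebra ℂ B] [StarModule ℂ B]
    [Ring A] [StarRing A] [Algebra ℂ A] [StarModule ℂ A] (P : StarProbSpace B A)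

/-- The product `a^{ε(1)} b₁ a^{ε(2)} b₂ ⋯ a^{ε(n)} b_n`, for the list of the pairs `(ε(k), b_k)`. -/
def listWord (a : A) (w : List (Fin 2 × B)) : A :=
  (w.map fun u => starPair a u.1 * P.incl u.2).prod

/-- `a` is `B`-valued R-diagonal: the odd alternating moments `E(a b₁ a* b₂ a ⋯ a* b_{2k} a)` vanish,
and `E(∏_V (∏_{k ∈ V} a^{ε(k)} b_k - E(∏_{k ∈ V} a^{ε(k)} b_k))) = 0` for every nonempty word, where
`V` runs through the maximal alternating intervals of `ε`, in increasing order. -/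
def IsRDiagonal (a : A) : Prop :=
  (∀ (k : ℕ) (b : Fin (2 * k) → B),
    P.moment (fun i : Fin (2 * k + 1) => starPair a (altIdx 0 i)) b = 0) ∧
  (∀ w : List (Fin 2 × B), w ≠ [] →
    P.E (((w.splitBy fun u v => u.1 != v.1).map
      fun V => P.listWord a V - P.incl (P.E (P.listWord a V))).prod) = 0)

/-- The alternating cumulant `α^{(1)}_{ℓ+1}` (for `i = 0`) or `α^{(2)}_{ℓ+1}` (for `i = 1`) of the
pair `(a, a*)`, attached to the alternating sequence of length `2ℓ + 2` that starts with `i`. -/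
def altCumulant (a : A) (i : Fin 2) (ℓ : ℕ) : MultilinearMap ℂ (fun _ : Fin (2 * ℓ + 1) => B) B :=
  P.cumulant (starPair a) (2 * ℓ + 1) (fun k => altIdx i k)

/-- The formal series `F(b₁, b₂) = ∑ₙ E((a b₁ a* b₂)ⁿ)`, as a power series over `B` in a variable that
records the degree; the `n`-th term has degree `2n`. -/
def seriesF (a : A) (b₁ b₂ : B) : PowerSeries B :=
  PowerSeries.mk fun d =>
    if Even d then P.E ((a * P.incl b₁ * star a * P.incl b₂) ^ (d / 2)) else 0

/-- The formal series `G(b₁, b₂) = ∑ₙ E((a* b₁ a b₂)ⁿ)`; the `n`-th term has degree `2n`. -/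
def seriesG (a : A) (b₁ b₂ : B) : PowerSeries B :=
  PowerSeries.mk fun d =>
    if Even d then P.E ((star a * P.incl b₁ * a * P.incl b₂) ^ (d / 2)) else 0

end StarProbSpace

/-! ## Formal power series: substitution and formal sums -/

/-- Substitution of formal series in a multilinear map, formally expanded: the term of degree `d` of
`φ(f₁, …, f_m)` is the sum over `d₁ + ⋯ + d_m = d` of `φ` at the terms of degrees `d₁, …, d_m`. -/
def MultilinearMap.substSeries {B : Type*} [Ring B] [Algebra ℂ B] {m : ℕ}
    (φ : MultilinearMap ℂ (fun _ : Fin m => B) B) (f : Fin m → PowerSeries B) : PowerSeries B :=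
  PowerSeries.mk fun d =>
    ∑ k ∈ Finset.finAntidiagonal m d, φ fun i => PowerSeries.coeff (k i) (f i)

/-- A sequence of formal series can be summed formally: in each degree only finitely many of them
have a nonzero term. -/
def FormallySummable {B : Type*} [Ring B] (f : ℕ → PowerSeries B) : Prop :=
  ∀ d : ℕ, {ℓ : ℕ | PowerSeries.coeff d (f ℓ) ≠ 0}.Finite

/-- The formal sum of a formally summable sequence of formal series, degree by degree. -/
def formalSum {B : Type*} [Ring B] (f : ℕ → PowerSeries B) : PowerSeries B :=
  PowerSeries.mk fun d => ∑ᶠ ℓ : ℕ, PowerSeries.coeff d (f ℓ)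

/-- The formal series `φ(u, w, u, w, …, w, u) w` (the map `φ` has `2ℓ + 1` arguments). -/
def MultilinearMap.alternatingSubst {B : Type*} [Ring B] [Algebra ℂ B] {ℓ : ℕ}
    (φ : MultilinearMap ℂ (fun _ : Fin (2 * ℓ + 1) => B) B) (u w : PowerSeries B) :
    PowerSeries B :=
  φ.substSeries (fun k => if Even (k : ℕ) then u else w) * w

/-! ## Multilinear function series -/

/-- A multilinear function series over `B`: for each `n` a `ℂ`-multilinear map `Bⁿ → B`; for `n = 0`
this is an element of `B`, the constant term. -/
@[ext]
structure MulSeries (B : Type*) [Ring B] [Algebra ℂ B] where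
  term : (n : ℕ) → MultilinearMap ℂ (fun _ : Fin n => B) B

namespace MulSeries

variable {B : Type*} [Ring B] [Algebra ℂ B]

/-- The sum, term by term. -/
instance : Add (MulSeries B) := ⟨fun X Ψ => ⟨fun n => X.term n + Ψ.term n⟩⟩

/-- The series with constant term `1` and no other terms. -/
instance : One (MulSeries B) :=
  ⟨⟨fun n => match n with
    | 0 => MultilinearMap.constOfIsEmpty ℂ (fun _ : Fin 0 => B) (1 : B)
    | _ + 1 => 0⟩⟩

/-- The series `I` whose term of degree `1` is the identity and whose other terms vanish. -/
def idSeries : MulSeries B := ⟨fun n => match n with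
  | 1 => MultilinearMap.ofSubsingleton ℂ B B (0 : Fin 1) LinearMap.id
  | _ => 0⟩

/-- `(b₁, …, b_n) ↦ χ_k(b₁, …, b_k) ψ_{n-k}(b_{k+1}, …, b_n)`. -/
def mulTerm (X Ψ : MulSeries B) (n : ℕ) (k : Fin (n + 1)) (b : Fin n → B) : B :=
  X.term k (fun i : Fin (k : ℕ) => b ⟨i, by omega⟩) *
    Ψ.term (n - k) (fun i : Fin (n - k) => b ⟨k + i, by omega⟩)

theorem mulTerm_multilin (X Ψ : MulSeries B) (n : ℕ) (k : Fin (n + 1)) :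
    IsMultilin (mulTerm X Ψ n k) := by
  intro b i r x y
  unfold mulTerm
  have inj1 : Function.Injective (fun t : Fin (k : ℕ) => (⟨t, by omega⟩ : Fin n)) := by
    intro s t e
    exact Fin.ext (by simpa using e)
  have inj2 : Function.Injective (fun t : Fin (n - k) => (⟨k + t, by omega⟩ : Fin n)) := by
    intro s t e
    exact Fin.ext (by simpa using e)
  by_cases h : (i : ℕ) < k
  · have e1 := fun z => update_comp_inj inj1 b ⟨i, h⟩ z
    have e2 := fun z => update_comp_not_mem (e := fun t : Fin (n - k) => (⟨k + t, by omega⟩ : Fin n))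
      b i (fun t e => by have := congrArg Fin.val e; simp at this; omega) z
    simp only at e1 e2
    simp only [e1, e2]
    rw [(X.term k).isMultilin, add_mul, smul_mul_assoc]
  · have hi : (⟨k + (i - k), by omega⟩ : Fin n) = i := Fin.ext (by simp; omega)
    have e1 := fun z => update_comp_inj inj2 b ⟨i - k, by omega⟩ z
    have e2 := fun z => update_comp_not_mem (e := fun t : Fin (k : ℕ) => (⟨t, by omega⟩ : Fin n))
      b i (fun t e => by have := congrArg Fin.val e; simp at this; omega) z
    simp only [hi] at e1
    simp only [e1, e2]
    rw [(Ψ.term (n - k)).isMultilin, mul_add, mul_smul_comm]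

/-- The product, with `n`-th term
`(b₁, …, b_n) ↦ ∑_{k=0}^n χ_k(b₁, …, b_k) ψ_{n-k}(b_{k+1}, …, b_n)`. -/
instance : Mul (MulSeries B) :=
  ⟨fun X Ψ => ⟨fun n => ∑ k : Fin (n + 1), (mulTerm_multilin X Ψ n k).toMultilinearMap⟩⟩

/-- For a composition `n = k(1) + ⋯ + k(p)` with all `k(t) ≥ 1`, the function
`χ_p(ψ^{(f(p,1))}_{k(1)}(b₁, …, b_{k(1)}), …, ψ^{(f(p,p))}_{k(p)}(…, b_n))`. -/
def compTerm {ι : Type*} (X : MulSeries B) (f : (p : ℕ) → Fin p → ι) (Ψ : ι → MulSeries B)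
    {n : ℕ} (κ : Composition n) (b : Fin n → B) : B :=
  X.term κ.length fun t => (Ψ (f κ.length t)).term (κ.blocksFun t) fun i => b (κ.embedding t i)

theorem compTerm_multilin {ι : Type*} (X : MulSeries B) (f : (p : ℕ) → Fin p → ι)
    (Ψ : ι → MulSeries B) {n : ℕ} (κ : Composition n) : IsMultilin (compTerm X f Ψ κ) := by
  intro b i r x y
  have key : ∀ z : B, (fun t => (Ψ (f κ.length t)).term (κ.blocksFun t)
        fun s => Function.update b i z (κ.embedding t s)) =
      Function.update (fun t => (Ψ (f κ.length t)).term (κ.blocksFun t) fun s => b (κ.embedding t s))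
        (κ.index i) ((Ψ (f κ.length (κ.index i))).term (κ.blocksFun (κ.index i))
          (Function.update (fun s => b (κ.embedding (κ.index i) s)) (κ.invEmbedding i) z)) := by
    intro z
    funext t
    by_cases ht : t = κ.index i
    · subst ht
      rw [Function.update_self]
      have := update_comp_inj (κ.embedding (κ.index i)).injective b (κ.invEmbedding i) z
      rw [κ.embedding_comp_inv i] at this
      rw [this]
    · rw [Function.update_of_ne ht]
      congr 1
      refine update_comp_not_mem b i (fun s e => ht ?_) z
      have : i ∈ Set.range (κ.embedding t) := ⟨s, e⟩
      rwa [κ.mem_range_embedding_iff'] at this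
  unfold compTerm
  simp only [key]
  rw [((Ψ _).term _).isMultilin, (X.term κ.length).isMultilin]

/-- The multivariate composition of `X` with a family of series `Ψ^{(i)}` (with zero constant terms),
in which `Ψ^{(f(p,t))}` is substituted for the `t`-th argument of the `p`-th term of `X`. -/
def comp {ι : Type*} (X : MulSeries B) (f : (p : ℕ) → Fin p → ι) (Ψ : ι → MulSeries B) :
    MulSeries B :=
  ⟨fun n => ∑ κ : Composition n, (compTerm_multilin X f Ψ κ).toMultilinearMap⟩

end MulSeries

namespace StarProbSpace

variable {B A : Type*} [Ring B] [StarRing B] [Algebra ℂ B] [StarModule ℂ B]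
    [Ring A] [StarRing A] [Algebra ℂ A] [StarModule ℂ A] (P : StarProbSpace B A)

/-- The moment series `M^{(1)}` (for `i = 0`) or `M^{(2)}` (for `i = 1`): the constant term is `1`, the
odd terms vanish, and the term of degree `2n` sends `(b₁, …, b_{2n})` to
`E(a b₁ a* b₂ ⋯ a b_{2n-1} a* b_{2n})`, respectively `E(a* b₁ a b₂ ⋯ a* b_{2n-1} a b_{2n})`. -/
def momentSeries (a : A) (i : Fin 2) : MulSeries B := ⟨fun n =>
  if Even n then P.E.compMultilinearMap (P.word fun k : Fin n => starPair a (altIdx i k)) else 0⟩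

/-- The cumulant series `A^{(1)}` (for `i = 0`) or `A^{(2)}` (for `i = 1`): the even terms vanish, and
the term of degree `2ℓ + 1` is the alternating cumulant of order `2ℓ + 2` that starts with `i`. -/
def cumulantSeries (a : A) (i : Fin 2) : MulSeries B := ⟨fun n =>
  if Odd n then P.cumulant (starPair a) n (fun k => altIdx i k) else 0⟩

end StarProbSpace

end

open scoped BigOperators

noncomputable section

/-! The moment-cumulant sum is split according to the block v_0 < ... < v_N of the first letter. A
noncrossing partition consists of this block and of arbitrary noncrossing partitions of the gaps
between consecutive v_t and of the tail after v_N. By multilinearity the sums over the gap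
partitions move inside the arguments of the cumulant, where the moment-cumulant formula turns them
back into moments. Hence a moment is a sum over first blocks of a cumulant with arguments b_{v_t} ·
(moment of the gap after v_t), times b_{v_N} · (moment of the tail). This is
`nestedSum_eq_sum_composition`, and `wordMoment_succ` after the identification `nestedSum_cumulant`.

For a word alternating in a and a*, R-diagonality enters through the vanishing of odd alternating
moments; those starting with a* are adjoints of those starting with a. Only gaps and tails of even
length survive, so the v_t alternate in parity, the cumulant is an alternating one, and in a word of
even length the first block has evenly many points. Recording the block by the composition whose
parts are the gap lengths plus one gives exactly the expansion of the composition with the series I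
M: the extra one is the degree of I. This is `momentSeries_eq`.

The identities for F and G are the evaluation at b₁, b₂, b₁, .... Since the v_t alternate in parity,
the coefficients seen by the t-th argument start with b₁ or b₂ according to the parity of t alone.
Compositions are then traded for tuples of degrees, which costs nothing because the substituted
series have no constant term. -/

/-! ### Noncrossing partitions encoded by block minima. -/

/-- The map sending each point of `[p, q)` to the least element of its block, for a noncrossing
partition of `[p, q)`, extended by the identity. -/
structure IsBlockMin (p q : ℕ) (f : ℕ → ℕ) : Prop where
  outside : ∀ s, ¬ (p ≤ s ∧ s < q) → f s = s
  lower : ∀ s, p ≤ s → s < q → p ≤ f s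
  le : ∀ s, f s ≤ s
  idem : ∀ s, f (f s) = f s
  noncrossing : ∀ s t, f s < t → t < s → f s ≤ f t

/-- Such a map fixes everything from q on and satisfies f s ≤ s, so its values below q, which are
themselves below q, determine it. The truncation by `min` only makes the target finite. -/
theorem IsBlockMin.finite (p q : ℕ) : {f | IsBlockMin p q f}.Finite := by
  refine Set.Finite.of_finite_image
    (f := fun f (i : Fin q) => (⟨min (f i) q, by omega⟩ : Fin (q + 1))) (Set.toFinite _) ?_
  intro f hf g hg h
  funext s
  by_cases hs : s < q
  · have := congrArg Fin.val (congrFun h ⟨s, hs⟩)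
    have h1 := hf.le s
    have h2 := hg.le s
    simp only at this
    omega
  · rw [hf.outside s (by omega), hg.outside s (by omega)]

/-- The noncrossing partitions of `[p, q)`, encoded by the least elements of the blocks. -/
def blockMins (p q : ℕ) : Finset (ℕ → ℕ) := (IsBlockMin.finite p q).toFinset

theorem mem_blockMins {p q : ℕ} {f : ℕ → ℕ} : f ∈ blockMins p q ↔ IsBlockMin p q f := by
  simp [blockMins]

/-! ### Nested evaluation on intervals of natural numbers. -/

section Nested

variable {I B : Type*} [Ring B] [Algebra ℂ B]
  (α : (k : ℕ) → (Fin (k + 1) → I) → MultilinearMap ℂ (fun _ : Fin k => B) B) (j : ℕ → I)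

/-- `α_{j|V}(g(v₀), …, g(v_{k-1})) g(v_k)` for `V = {v₀ < ⋯ < v_k}`. -/
def blockEval (V : Finset ℕ) (g : ℕ → B) : B :=
  if h : V.card = V.card - 1 + 1 then
    α (V.card - 1) (fun i => j (V.orderEmbOfFin h i)) (fun i => g (V.orderEmbOfFin h i.castSucc)) *
      g (V.orderEmbOfFin h (Fin.last _))
  else 1

/-- Replaces the literal `V.card - 1`, on which types depend, by any N known to equal it. -/
theorem blockEval_of_card {V : Finset ℕ} {N : ℕ} (h : V.card = N + 1) (g : ℕ → B) :
    blockEval α j V g =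
      α N (fun i => j (V.orderEmbOfFin h i)) (fun i => g (V.orderEmbOfFin h i.castSucc)) *
        g (V.orderEmbOfFin h (Fin.last _)) := by
  have hN : V.card - 1 = N := by omega
  have h' : V.card = V.card - 1 + 1 := by omega
  unfold blockEval
  rw [dif_pos h']
  generalize V.card - 1 = M at *
  subst hN
  rfl

theorem blockEval_congr {V : Finset ℕ} {g g' : ℕ → B} (h : ∀ v ∈ V, g v = g' v) :
    blockEval α j V g = blockEval α j V g' := by
  unfold blockEval
  split_ifs with hV
  · have h1 : ∀ i, g (V.orderEmbOfFin hV i) = g' (V.orderEmbOfFin hV i) := fun i =>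
      h _ (V.orderEmbOfFin_mem hV i)
    simp only [h1]
  · rfl

theorem blockEval_image {N : ℕ} {v : ℕ → ℕ} (hv : ∀ t < N, v t < v (t + 1)) (g : ℕ → B) :
    blockEval α j ((Finset.range (N + 1)).image v) g =
      α N (fun t => j (v t)) (fun t => g (v t)) * g (v N) := by
  have hmono : StrictMono (fun t : Fin (N + 1) => v t) :=
    Fin.strictMono_iff_lt_succ.2 fun i => by simpa using hv i i.2
  have himg : (Finset.range (N + 1)).image v = Finset.univ.image (fun t : Fin (N + 1) => v t) := by
    ext s
    simp only [Finset.mem_image, Finset.mem_range, Finset.mem_univ, true_and]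
    exact ⟨fun ⟨t, ht, e⟩ => ⟨⟨t, ht⟩, e⟩, fun ⟨t, e⟩ => ⟨t, t.2, e⟩⟩
  have hcard : ((Finset.range (N + 1)).image v).card = N + 1 := by
    rw [himg, Finset.card_image_of_injective _ hmono.injective]
    simp
  have huniq := Finset.orderEmbOfFin_unique hcard (f := fun t : Fin (N + 1) => v t)
    (fun t => by rw [himg]; exact Finset.mem_image_of_mem _ (Finset.mem_univ t)) hmono
  rw [blockEval_of_card α j hcard, ← huniq]
  rfl

variable (b : ℕ → B)

/-- The value of the part of the word `x_s b_s ⋯ x_{q-1} b_{q-1}` from position `s` on, up to the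
first position that is not the least one of its block. -/
def nestAt (f : ℕ → ℕ) (q s : ℕ) : B :=
  if s < q ∧ f s = s then
    blockEval α j ((Finset.Ico s q).filter fun t => f t = s)
      (fun v => if s ≤ v ∧ v < q then b v * nestAt f q (v + 1) else 0)
  else 1
termination_by q - s

theorem nestAt_of_min {f : ℕ → ℕ} {q s : ℕ} (hs : s < q) (hf : f s = s) :
    nestAt α j b f q s = blockEval α j ((Finset.Ico s q).filter fun t => f t = s)
      (fun v => b v * nestAt α j b f q (v + 1)) := by
  rw [nestAt, if_pos ⟨hs, hf⟩]
  refine blockEval_congr α j fun v hv => ?_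
  rw [Finset.mem_filter, Finset.mem_Ico] at hv
  rw [if_pos hv.1]

theorem nestAt_of_not {f : ℕ → ℕ} {q s : ℕ} (h : ¬ (s < q ∧ f s = s)) :
    nestAt α j b f q s = 1 := by
  rw [nestAt, if_neg h]

/-- Evaluation from s stays inside [p, q) if no block with its minimum there reaches beyond q and q
does not open a new block: a position that is not a block minimum stops the evaluation exactly as
the end of the word does. -/
theorem nestAt_restrict {f f' : ℕ → ℕ} {p q n : ℕ} (hqn : q ≤ n)
    (hff : ∀ s, p ≤ s → s < q → f s = f' s) (hout : ∀ s t, p ≤ s → s < q → q ≤ t → t < n → f t ≠ s)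
    (hq : q < n → f q ≠ q) (s : ℕ) (hps : p ≤ s) (hsq : s ≤ q) :
    nestAt α j b f n s = nestAt α j b f' q s := by
  induction hd : q - s using Nat.strong_induction_on generalizing s with
  | _ d ih =>
    rcases hsq.eq_or_lt with rfl | hlt
    · rw [nestAt_of_not, nestAt_of_not]
      · omega
      · exact fun h => hq h.1 h.2
    · by_cases hfs : f s = s
      · rw [nestAt_of_min α j b (by omega) hfs, nestAt_of_min α j b hlt (by rw [← hff s hps hlt, hfs])]
        have hV : (Finset.Ico s n).filter (fun t => f t = s) =
            (Finset.Ico s q).filter (fun t => f' t = s) := by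
          ext t
          simp only [Finset.mem_filter, Finset.mem_Ico]
          constructor
          · rintro ⟨⟨h1, h2⟩, h3⟩
            have : t < q := by
              by_contra h
              exact hout s t hps hlt (by omega) h2 h3
            exact ⟨⟨h1, this⟩, by rw [← hff t (by omega) this, h3]⟩
          · rintro ⟨⟨h1, h2⟩, h3⟩
            exact ⟨⟨h1, by omega⟩, by rw [hff t (by omega) h2, h3]⟩
        rw [hV]
        refine blockEval_congr α j fun v hv => ?_
        rw [Finset.mem_filter, Finset.mem_Ico] at hv
        rw [ih (q - (v + 1)) (by omega) (v + 1) (by omega) (by omega) rfl]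
      · rw [nestAt_of_not, nestAt_of_not]
        · exact fun h => hfs (by rw [hff s hps hlt, h.2])
        · exact fun h => hfs h.2

/-- The sum of the values of the word `x_p b_p ⋯ x_{q-1} b_{q-1}` over all noncrossing partitions. -/
def nestedSum (p q : ℕ) : B := ∑ f ∈ blockMins p q, nestAt α j b f q p

end Nested

/-! ### Gluing and restricting along the gaps of a block. -/

/-- Gluing of maps given on the gaps between the points `v t`. -/
def glueGaps (v : ℕ → ℕ) (N : ℕ) (r : Fin (N + 1) → ℕ → ℕ) (s : ℕ) : ℕ :=
  -- Each `r t` is the identity off its own gap, so at most one difference is nonzero: the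
  -- expression is `r t s` in the gap of index t and s outside all gaps, with no need to choose the
  -- gap.
  if s ∈ (Finset.range (N + 1)).image v then v 0 else s - ∑ t, (s - r t s)

theorem exists_le_lt_succ {v : ℕ → ℕ} {N s : ℕ} (h0 : v 0 ≤ s) (hN : s < v N) :
    ∃ t < N, v t ≤ s ∧ s < v (t + 1) := by
  induction N with
  | zero => omega
  | succ N ih =>
    by_cases h : s < v N
    · obtain ⟨t, ht, h1⟩ := ih h
      exact ⟨t, by omega, h1⟩
    · exact ⟨N, by omega, by omega, hN⟩

theorem lt_of_lt_steps {v : ℕ → ℕ} {N : ℕ} (hv : ∀ t ≤ N, v t < v (t + 1)) {s t : ℕ} (hst : s < t)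
    (ht : t ≤ N + 1) : v s < v t := by
  induction t with
  | zero => omega
  | succ t ih =>
    rcases (Nat.lt_succ_iff.1 hst).eq_or_lt with rfl | h
    · exact hv _ (by omega)
    · exact (ih h (by omega)).trans (hv _ (by omega))

theorem eq_of_mem_gaps {v : ℕ → ℕ} {N : ℕ} (hv : ∀ t ≤ N, v t < v (t + 1)) {s t t' : ℕ}
    (ht : t ≤ N) (ht' : t' ≤ N) (h1 : v t ≤ s) (h2 : s < v (t + 1)) (h1' : v t' ≤ s)
    (h2' : s < v (t' + 1)) : t = t' := by
  by_contra hne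
  rcases Nat.lt_or_gt_of_ne hne with h | h
  · rcases (show t + 1 ≤ t' from h).eq_or_lt with e | h'
    · subst e; omega
    · have := lt_of_lt_steps hv h' (by omega)
      omega
  · rcases (show t' + 1 ≤ t from h).eq_or_lt with e | h'
    · subst e; omega
    · have := lt_of_lt_steps hv h' (by omega)
      omega

theorem glueGaps_of_mem {v : ℕ → ℕ} {N t : ℕ} (ht : t ≤ N) (r : Fin (N + 1) → ℕ → ℕ) :
    glueGaps v N r (v t) = v 0 := by
  rw [glueGaps, if_pos (Finset.mem_image_of_mem _ (Finset.mem_range.2 (by omega)))]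

section Glue

variable {v : ℕ → ℕ} {N : ℕ} {r : Fin (N + 1) → ℕ → ℕ}

theorem glueGaps_of_gap (hv : ∀ t ≤ N, v t < v (t + 1))
    (hr : ∀ t : Fin (N + 1), IsBlockMin (v t + 1) (v (t + 1)) (r t)) {t : Fin (N + 1)} {s : ℕ}
    (h1 : v t < s) (h2 : s < v (t + 1)) : glueGaps v N r s = r t s := by
  rw [glueGaps, if_neg, Finset.sum_eq_single t]
  · have := (hr t).le s
    omega
  · intro t' _ hne
    rw [(hr t').outside s, Nat.sub_self]
    rintro ⟨h3, h4⟩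
    exact hne (Fin.ext (eq_of_mem_gaps hv (by omega) (by omega) (by omega) h4 h1.le h2))
  · simp
  · intro h
    obtain ⟨t', ht', rfl⟩ := Finset.mem_image.1 h
    rw [Finset.mem_range] at ht'
    have := eq_of_mem_gaps hv (by omega) (by omega) le_rfl (hv t' (by omega)) h1.le h2
    subst this
    omega

theorem glueGaps_of_outside (hv : ∀ t ≤ N, v t < v (t + 1))
    (hr : ∀ t : Fin (N + 1), IsBlockMin (v t + 1) (v (t + 1)) (r t)) {s : ℕ}
    (h : ¬ (v 0 ≤ s ∧ s < v (N + 1))) : glueGaps v N r s = s := by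
  have hle0 : ∀ t ≤ N + 1, v 0 ≤ v t := fun t ht => by
    rcases Nat.eq_zero_or_pos t with rfl | h
    · exact le_rfl
    · exact (lt_of_lt_steps hv h ht).le
  have hleN : ∀ t ≤ N + 1, v t ≤ v (N + 1) := fun t ht => by
    rcases ht.eq_or_lt with rfl | h
    · exact le_rfl
    · exact (lt_of_lt_steps hv h le_rfl).le
  rw [glueGaps, if_neg, Finset.sum_eq_zero, Nat.sub_zero]
  · intro t _
    rw [(hr t).outside s, Nat.sub_self]
    rintro ⟨h3, h4⟩
    exact h ⟨by have := hle0 t (by omega); omega, h4.trans_le (hleN _ (by omega))⟩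
  · intro hs
    obtain ⟨t', ht', rfl⟩ := Finset.mem_image.1 hs
    rw [Finset.mem_range] at ht'
    exact h ⟨hle0 _ (by omega), lt_of_lt_steps hv ht' le_rfl⟩

/-- A point of `[v 0, v (N + 1))` is one of the `v t` or lies in one of the gaps. -/
theorem mem_or_mem_gap {s : ℕ} (h0 : v 0 ≤ s) (hN : s < v (N + 1)) :
    (∃ t ≤ N, s = v t) ∨ ∃ t : Fin (N + 1), v t < s ∧ s < v (t + 1) := by
  obtain ⟨t, ht, h1, h2⟩ := exists_le_lt_succ h0 hN
  rcases h1.eq_or_lt with e | h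
  · exact Or.inl ⟨t, by omega, e.symm⟩
  · exact Or.inr ⟨⟨t, ht⟩, h, h2⟩

theorem IsBlockMin.mem_Ico {p q : ℕ} {f : ℕ → ℕ} (hf : IsBlockMin p q f) {s : ℕ} (h1 : p ≤ s)
    (h2 : s < q) : p ≤ f s ∧ f s < q :=
  ⟨hf.lower s h1 h2, (hf.le s).trans_lt h2⟩

/-- The minimum of a block inside a gap lies in the same gap, so an arc of such a block never meets
another gap or a point `v t`; and an arc of the outer block starts at `v 0`, below every other value
in the interval. -/
theorem IsBlockMin.glueGaps (hv : ∀ t ≤ N, v t < v (t + 1))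
    (hr : ∀ t : Fin (N + 1), IsBlockMin (v t + 1) (v (t + 1)) (r t)) :
    IsBlockMin (v 0) (v (N + 1)) (glueGaps v N r) := by
  have hle0 : ∀ t ≤ N + 1, v 0 ≤ v t := fun t ht => by
    rcases Nat.eq_zero_or_pos t with rfl | h
    · exact le_rfl
    · exact (lt_of_lt_steps hv h ht).le
  have h00 : _root_.glueGaps v N r (v 0) = v 0 := glueGaps_of_mem (Nat.zero_le N) r
  have cases : ∀ s, (_root_.glueGaps v N r s = s) ∨ (_root_.glueGaps v N r s = v 0 ∧ v 0 ≤ s) ∨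
      ∃ t : Fin (N + 1), v t < s ∧ s < v (t + 1) ∧ _root_.glueGaps v N r s = r t s := by
    intro s
    by_cases hs : v 0 ≤ s ∧ s < v (N + 1)
    · rcases mem_or_mem_gap hs.1 hs.2 with ⟨t, ht, rfl⟩ | ⟨t, h1, h2⟩
      · exact Or.inr (Or.inl ⟨glueGaps_of_mem ht r, hs.1⟩)
      · exact Or.inr (Or.inr ⟨t, h1, h2, glueGaps_of_gap hv hr h1 h2⟩)
    · exact Or.inl (glueGaps_of_outside hv hr hs)
  refine ⟨fun s hs => glueGaps_of_outside hv hr hs, ?_, ?_, ?_, ?_⟩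
  · intro s h1 h2
    rcases cases s with h | ⟨h, _⟩ | ⟨t, h3, h4, h5⟩
    · omega
    · omega
    · have := ((hr t).mem_Ico h3 h4).1
      have := hle0 t (by omega)
      omega
  · intro s
    rcases cases s with h | ⟨h, _⟩ | ⟨t, h3, h4, h5⟩
    · omega
    · omega
    · have := (hr t).le s
      omega
  · intro s
    rcases cases s with h | ⟨h, _⟩ | ⟨t, h3, h4, h5⟩
    · rw [h, h]
    · rw [h, h00]
    · have := (hr t).mem_Ico h3 h4
      rw [h5, glueGaps_of_gap hv hr (by omega) this.2, (hr t).idem]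
  · intro s u h1 h2
    rcases cases s with h | ⟨h, _⟩ | ⟨t, h3, h4, h5⟩
    · omega
    · rw [h] at h1 ⊢
      rcases cases u with h' | ⟨h', _⟩ | ⟨t, h3, h4, h5⟩
      · omega
      · omega
      · have := ((hr t).mem_Ico h3 h4).1
        have := hle0 t (by omega)
        omega
    · have := (hr t).mem_Ico h3 h4
      rw [h5] at h1 ⊢
      rw [glueGaps_of_gap hv hr (by omega) (h2.trans h4)]
      exact (hr t).noncrossing s u h1 h2

/-- The restriction of a noncrossing partition to a gap between two points of its first block. -/
theorem IsBlockMin.restrict_gap {f : ℕ → ℕ} {p q l m : ℕ} (hf : IsBlockMin p q f) (hpl : p ≤ l)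
    (hmq : m ≤ q) (hl : f l = p) (hgap : ∀ s, l < s → s < m → f s ≠ p) :
    IsBlockMin (l + 1) m (fun s => if l < s ∧ s < m then f s else s) := by
  -- A block meeting the gap cannot reach back to l: if its minimum is l, idempotence puts it in the
  -- block of p; if its minimum is below l, noncrossing with l pushes it down to p. Both are
  -- excluded by `hgap`.
  have key : ∀ s, l < s → s < m → l < f s := by
    intro s h1 h2
    by_contra h
    have h3 : p ≤ f s := hf.lower s (by omega) (by omega)
    rcases (not_lt.1 h).eq_or_lt with e | h'
    · exact hgap s h1 h2 (by rw [← hf.idem s, e, hl])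
    · have := hf.noncrossing s l h' h1
      exact hgap s h1 h2 (by omega)
  refine ⟨?_, ?_, ?_, ?_, ?_⟩
  · intro s hs
    exact if_neg (by omega)
  · intro s h1 h2
    rw [if_pos (by omega)]
    exact key s (by omega) h2
  · intro s
    split_ifs
    · exact hf.le s
    · exact le_rfl
  · intro s
    by_cases h : l < s ∧ s < m
    · have h1 := key s h.1 h.2
      have h2 := hf.le s
      simp only [if_pos h]
      rw [if_pos (by omega), hf.idem]
    · simp only [if_neg h]
  · intro s t h1 h2
    by_cases h : l < s ∧ s < m
    · have h3 := key s h.1 h.2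
      simp only [if_pos h] at h1 ⊢
      rw [if_pos (by omega)]
      exact hf.noncrossing s t h1 h2
    · simp only [if_neg h] at h1
      omega

end Glue

/-! ### Summation over partitions with a prescribed first block. -/

section Recursion

variable {I B : Type*} [Ring B] [Algebra ℂ B]
  (α : (k : ℕ) → (Fin (k + 1) → I) → MultilinearMap ℂ (fun _ : Fin k => B) B) (j : ℕ → I) (b : ℕ → B)

/-- The multilinear map `c ↦ φ(c₀, …, c_{N-1}) c_N`. -/
def MultilinearMap.mulLast {N : ℕ} (φ : MultilinearMap ℂ (fun _ : Fin N => B) B) :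
    MultilinearMap ℂ (fun _ : Fin (N + 1) => B) B :=
  MultilinearMap.uncurryRight (M := fun _ : Fin (N + 1) => B)
    ((LinearMap.mul ℂ B).compMultilinearMap φ)

theorem MultilinearMap.mulLast_apply {N : ℕ} (φ : MultilinearMap ℂ (fun _ : Fin N => B) B)
    (c : Fin (N + 1) → B) : φ.mulLast c = φ (fun i => c i.castSucc) * c (Fin.last N) := rfl

/-- Evaluation started after `v t` halts at `v (t + 1)`, which either is the end of the word or
belongs to the block of p and so is not a minimum. Noncrossing keeps the blocks of the gap from
extending past that point. -/
theorem nestAt_succ_of_firstBlock {p q N : ℕ} {v : ℕ → ℕ} (hv : ∀ t ≤ N, v t < v (t + 1))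
    (hq : v (N + 1) = q) {f : ℕ → ℕ} (hf : IsBlockMin p q f)
    (hV : (Finset.Ico p q).filter (fun s => f s = p) = (Finset.range (N + 1)).image v)
    {t : ℕ} (ht : t ≤ N) :
    nestAt α j b f q (v t + 1) =
      nestAt α j b (fun s => if v t < s ∧ s < v (t + 1) then f s else s) (v (t + 1)) (v t + 1) := by
  have hfv : ∀ t ≤ N, f (v t) = p := fun t ht => by
    have : v t ∈ (Finset.Ico p q).filter (fun s => f s = p) := by
      rw [hV]
      exact Finset.mem_image_of_mem _ (Finset.mem_range.2 (by omega))
    exact (Finset.mem_filter.1 this).2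
  have hpv : p ≤ v t := by
    rw [← hfv t ht]
    exact hf.le _
  have hvq : ∀ t ≤ N + 1, v t < q → t ≤ N := fun t ht h => by
    by_contra h'
    have : t = N + 1 := by omega
    subst this
    omega
  have hle : v (t + 1) ≤ q := by
    rcases ht.eq_or_lt with rfl | h
    · exact hq.le
    · rw [← hq]
      exact (lt_of_lt_steps hv (by omega) le_rfl).le
  have := hv t ht
  refine nestAt_restrict α j b (p := v t + 1) hle ?_ ?_ ?_ _ le_rfl this
  · intro s h1 h2
    rw [if_pos ⟨h1, h2⟩]
  · intro s u h1 h2 h3 h4 h5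
    have h6 := hfv (t + 1) (hvq _ (by omega) (by omega))
    rcases h3.eq_or_lt with rfl | h3
    · omega
    · have := hf.noncrossing u (v (t + 1)) (by omega) h3
      omega
  · intro h
    rw [hfv (t + 1) (hvq _ (by omega) h)]
    omega

/-- The sum over the noncrossing partitions of `[p, q)` with a given first block. -/
theorem sum_nestAt_firstBlock {p q N : ℕ} {v : ℕ → ℕ} (hv : ∀ t ≤ N, v t < v (t + 1))
    (h0 : v 0 = p) (hq : v (N + 1) = q) :
    ∑ f ∈ (blockMins p q).filter
        (fun f => (Finset.Ico p q).filter (fun s => f s = p) = (Finset.range (N + 1)).image v),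
      nestAt α j b f q p =
    α N (fun t => j (v t)) (fun t => b (v t) * nestedSum α j b (v t + 1) (v (t + 1))) *
      (b (v N) * nestedSum α j b (v N + 1) q) := by
  have hpq : p < q := by
    rw [← h0, ← hq]
    exact lt_of_lt_steps hv (by omega) le_rfl
  -- Absorbing the last factor into one multilinear map of N + 1 arguments treats the tail like the
  -- other gaps, so a single expansion of sums yields all families of gap partitions.
  have hR : α N (fun t => j (v t)) (fun t => b (v t) * nestedSum α j b (v t + 1) (v (t + 1))) *
      (b (v N) * nestedSum α j b (v N + 1) q) =
      (α N (fun t => j (v t))).mulLast (fun t : Fin (N + 1) =>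
        ∑ g ∈ blockMins (v t + 1) (v (t + 1)),
          b (v t) * nestAt α j b g (v (t + 1)) (v t + 1)) := by
    rw [MultilinearMap.mulLast_apply]
    simp only [nestedSum, Finset.mul_sum, Fin.val_castSucc, Fin.val_last, hq]
  rw [hR, MultilinearMap.map_sum_finset]
  -- Restriction to the gaps and gluing are mutually inverse.
  refine Finset.sum_bij'
    (fun f _ => fun (t : Fin (N + 1)) s => if v t < s ∧ s < v (t + 1) then f s else s)
    (fun r _ => glueGaps v N r) ?_ ?_ ?_ ?_ ?_
  · intro f hf
    rw [Finset.mem_filter, mem_blockMins] at hf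
    obtain ⟨hf, hV⟩ := hf
    have hmem : ∀ s, (p ≤ s ∧ s < q) ∧ f s = p ↔ ∃ t ≤ N, v t = s := fun s => by
      have := Finset.ext_iff.1 hV s
      simpa [Nat.lt_succ_iff] using this
    rw [Fintype.mem_piFinset]
    intro t
    rw [mem_blockMins]
    obtain ⟨⟨h1, h2⟩, h3⟩ := (hmem (v t)).2 ⟨t, by omega, rfl⟩
    have hle : v (t + 1) ≤ q := by
      rcases (show (t : ℕ) ≤ N by omega).eq_or_lt with h | h
      · rw [h, hq]
      · rw [← hq]
        exact (lt_of_lt_steps hv (by omega) le_rfl).le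
    refine hf.restrict_gap h1 hle h3 ?_
    intro s h4 h5 h6
    obtain ⟨t', ht', rfl⟩ := (hmem s).1 ⟨by omega, h6⟩
    have := eq_of_mem_gaps hv (by omega) ht' h4.le h5 le_rfl (hv t' ht')
    subst this
    omega
  · intro r hr
    rw [Fintype.mem_piFinset] at hr
    simp only [mem_blockMins] at hr
    rw [Finset.mem_filter, mem_blockMins]
    refine ⟨h0 ▸ hq ▸ IsBlockMin.glueGaps hv hr, ?_⟩
    ext s
    rw [Finset.mem_filter, Finset.mem_Ico, Finset.mem_image]
    constructor
    · rintro ⟨⟨h1, h2⟩, h3⟩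
      rcases mem_or_mem_gap (v := v) (N := N) (s := s) (by omega) (by omega) with
        ⟨t, ht, rfl⟩ | ⟨t, h4, h5⟩
      · exact ⟨t, Finset.mem_range.2 (by omega), rfl⟩
      · rw [glueGaps_of_gap hv hr h4 h5] at h3
        have := ((hr t).mem_Ico h4 h5).1
        have : v 0 ≤ v t := by
          rcases Nat.eq_zero_or_pos (t : ℕ) with h | h
          · rw [h]
          · exact (lt_of_lt_steps hv h (by omega)).le
        omega
    · rintro ⟨t, ht, rfl⟩
      rw [Finset.mem_range] at ht
      refine ⟨⟨?_, ?_⟩, by rw [glueGaps_of_mem (by omega), h0]⟩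
      · rw [← h0]
        rcases Nat.eq_zero_or_pos (t : ℕ) with h | h
        · rw [h]
        · exact (lt_of_lt_steps hv h (by omega)).le
      · rw [← hq]
        exact lt_of_lt_steps hv ht le_rfl
  · intro f hf
    rw [Finset.mem_filter, mem_blockMins] at hf
    obtain ⟨hf, hV⟩ := hf
    have hmem : ∀ s, (p ≤ s ∧ s < q) ∧ f s = p ↔ ∃ t ≤ N, v t = s := fun s => by
      have := Finset.ext_iff.1 hV s
      simpa [Nat.lt_succ_iff] using this
    have hgap : ∀ (t : Fin (N + 1)) (s : ℕ), s - (if v t < s ∧ s < v (t + 1) then f s else s) =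
        if v t < s ∧ s < v (t + 1) then s - f s else 0 := by
      intro t s
      split_ifs <;> simp
    funext s
    by_cases hs : p ≤ s ∧ s < q
    · by_cases hsV : ∃ t ≤ N, v t = s
      · obtain ⟨t, ht, rfl⟩ := hsV
        rw [glueGaps_of_mem ht, ((hmem (v t)).2 ⟨t, ht, rfl⟩).2, h0]
      · rcases mem_or_mem_gap (v := v) (N := N) (s := s) (by omega) (by omega) with
          ⟨t, ht, rfl⟩ | ⟨t, h4, h5⟩
        · exact absurd ⟨t, ht, rfl⟩ hsV
        · rw [glueGaps, if_neg, Finset.sum_eq_single t]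
          · rw [if_pos ⟨h4, h5⟩]
            have := hf.le s
            omega
          · intro t' _ hne
            rw [if_neg, Nat.sub_self]
            rintro ⟨h6, h7⟩
            exact hne (Fin.ext (eq_of_mem_gaps hv (by omega) (by omega) h6.le h7 h4.le h5))
          · simp
          · simpa [Nat.lt_succ_iff] using hsV
    · rw [hf.outside s hs, glueGaps, if_neg, Finset.sum_eq_zero, Nat.sub_zero]
      · intro t _
        rw [hgap]
        split_ifs with h
        · rw [hf.outside s hs, Nat.sub_self]
        · rfl
      · intro h
        rw [Finset.mem_image] at h
        obtain ⟨t, ht, rfl⟩ := h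
        rw [Finset.mem_range] at ht
        exact hs ((hmem _).2 ⟨t, by omega, rfl⟩).1
  · intro r hr
    rw [Fintype.mem_piFinset] at hr
    simp only [mem_blockMins] at hr
    funext t s
    by_cases h : v t < s ∧ s < v (t + 1)
    · rw [if_pos h, glueGaps_of_gap hv hr h.1 h.2]
    · rw [if_neg h, (hr t).outside s h]
  · intro f hf
    rw [Finset.mem_filter, mem_blockMins] at hf
    obtain ⟨hf, hV⟩ := hf
    have hfp : f p = p := le_antisymm (hf.le p) (hf.lower p le_rfl hpq)
    rw [nestAt_of_min α j b hpq hfp, hV, blockEval_image α j (fun t ht => hv t (by omega)),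
      MultilinearMap.mulLast_apply]
    simp only [Fin.val_castSucc, Fin.val_last]
    rw [← nestAt_succ_of_firstBlock α j b hv hq hf hV le_rfl]
    congr 2
    funext t
    rw [← nestAt_succ_of_firstBlock α j b hv hq hf hV (by omega)]

end Recursion

/-! ### First blocks as partial sums of compositions. -/

theorem Composition.image_sizeUpTo (p : ℕ) {k : ℕ} (κ : Composition k) :
    (Finset.range (κ.length + 1)).image (fun t => p + κ.sizeUpTo t) =
      κ.boundaries.image (fun i : Fin (k + 1) => p + (i : ℕ)) := by
  ext s
  simp only [Finset.mem_image, Finset.mem_range, Composition.boundaries, Finset.mem_map,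
    Finset.mem_univ, true_and]
  constructor
  · rintro ⟨t, ht, rfl⟩
    exact ⟨_, ⟨⟨t, ht⟩, rfl⟩, rfl⟩
  · rintro ⟨_, ⟨t, rfl⟩, rfl⟩
    exact ⟨t, t.2, rfl⟩

/-- The largest point of the set is p + k, which recovers k; the set is then the shifted set of
boundaries, which recovers the composition. -/
theorem Composition.image_sizeUpTo_injective (p : ℕ) : Function.Injective
    (fun κ : Σ k, Composition k =>
      (Finset.range (κ.2.length + 1)).image (fun t => p + κ.2.sizeUpTo t)) := by
  have hle : ∀ {k k' : ℕ} (κ : Composition k) (κ' : Composition k'),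
      (Finset.range (κ.length + 1)).image (fun t => p + κ.sizeUpTo t) =
      (Finset.range (κ'.length + 1)).image (fun t => p + κ'.sizeUpTo t) → k ≤ k' := by
    intro k k' κ κ' h
    have : p + k ∈ (Finset.range (κ.length + 1)).image (fun t => p + κ.sizeUpTo t) :=
      Finset.mem_image.2 ⟨κ.length, by simp, by simp⟩
    rw [h, Finset.mem_image] at this
    obtain ⟨t, _, ht⟩ := this
    have := κ'.sizeUpTo_le t
    omega
  rintro ⟨k, κ⟩ ⟨k', κ'⟩ h
  obtain rfl : k = k' := le_antisymm (hle κ κ' h) (hle κ' κ h.symm)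
  simp only [Composition.image_sizeUpTo] at h
  have hinj : Function.Injective (fun i : Fin (k + 1) => p + (i : ℕ)) := fun i i' e => by
    have e' : p + (i : ℕ) = p + i' := e
    exact Fin.ext (by omega)
  have hb := Finset.image_injective hinj h
  have : κ = κ' := (compositionEquiv k).injective (CompositionAsSet.ext hb)
  rw [this]

theorem Composition.exists_image_sizeUpTo {p q : ℕ} {V : Finset ℕ} (hV : V ⊆ Finset.Ico p q)
    (hp : p ∈ V) : ∃ k < q - p, ∃ κ : Composition k,
      (Finset.range (κ.length + 1)).image (fun t => p + κ.sizeUpTo t) = V := by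
  have hmax := V.max'_mem ⟨p, hp⟩
  have hmax' := Finset.mem_Ico.1 (hV hmax)
  obtain ⟨k, hk⟩ : ∃ k, V.max' ⟨p, hp⟩ = p + k := ⟨_, (Nat.add_sub_cancel' hmax'.1).symm⟩
  rw [hk] at hmax
  have hk' : ∀ s ∈ V, p ≤ s ∧ s < p + k + 1 := fun s hs => by
    have h1 := V.le_max' s hs
    have h2 := Finset.mem_Ico.1 (hV hs)
    omega
  let c : CompositionAsSet k :=
    { boundaries := Finset.univ.filter fun i : Fin (k + 1) => p + (i : ℕ) ∈ V
      zero_mem := by simpa using hp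
      getLast_mem := by simpa using hmax }
  refine ⟨k, by omega, c.toComposition, ?_⟩
  rw [Composition.image_sizeUpTo, CompositionAsSet.toComposition_boundaries]
  ext s
  simp only [c, Finset.mem_image, Finset.mem_filter, Finset.mem_univ, true_and]
  constructor
  · rintro ⟨i, hi, rfl⟩
    exact hi
  · intro hs
    have := hk' s hs
    exact ⟨⟨s - p, by omega⟩, by simpa [Nat.add_sub_cancel' this.1] using hs,
      by simp [Nat.add_sub_cancel' this.1]⟩

section Recursion

variable {I B : Type*} [Ring B] [Algebra ℂ B]
  (α : (k : ℕ) → (Fin (k + 1) → I) → MultilinearMap ℂ (fun _ : Fin k => B) B) (j : ℕ → I)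

/-- The first-block recursion: the block of `p` is the set of partial sums of a composition. -/
theorem nestedSum_eq_sum_composition (b : ℕ → B) {p q : ℕ} (hpq : p < q) :
    nestedSum α j b p q = ∑ k ∈ Finset.range (q - p), ∑ κ : Composition k,
      α κ.length (fun t => j (p + κ.sizeUpTo t))
        (fun t => b (p + κ.sizeUpTo t) *
          nestedSum α j b (p + κ.sizeUpTo t + 1) (p + κ.sizeUpTo (t + 1))) *
        (b (p + k) * nestedSum α j b (p + k + 1) q) := by
  classical
  rw [Finset.sum_sigma' (Finset.range (q - p)) (fun k => (Finset.univ : Finset (Composition k)))]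
  have hmaps : ∀ f ∈ blockMins p q, (Finset.Ico p q).filter (fun s => f s = p) ∈
      ((Finset.range (q - p)).sigma fun k => (Finset.univ : Finset (Composition k))).image
        (fun κ => (Finset.range (κ.2.length + 1)).image (fun t => p + κ.2.sizeUpTo t)) := by
    intro f hf
    rw [mem_blockMins] at hf
    obtain ⟨k, hk, κ, h⟩ := Composition.exists_image_sizeUpTo (p := p) (q := q)
      (V := (Finset.Ico p q).filter (fun s => f s = p)) (Finset.filter_subset _ _)
      (Finset.mem_filter.2 ⟨Finset.mem_Ico.2 ⟨le_rfl, hpq⟩,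
        le_antisymm (hf.le p) (hf.lower p le_rfl hpq)⟩)
    exact Finset.mem_image.2 ⟨⟨k, κ⟩, by simpa using hk, h⟩
  rw [nestedSum, ← Finset.sum_fiberwise_of_maps_to hmaps,
    Finset.sum_image (fun κ _ κ' _ h => Composition.image_sizeUpTo_injective p h)]
  refine Finset.sum_congr rfl ?_
  rintro ⟨k, κ⟩ hk
  have hk' : k < q - p := by simpa using hk
  -- The enumeration of the block has to be continued by q at index `κ.length + 1`; `sizeUpTo`
  -- itself would remain at k there.
  have hv : ∀ t ≤ κ.length, (if t ≤ κ.length then p + κ.sizeUpTo t else q) <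
      if t + 1 ≤ κ.length then p + κ.sizeUpTo (t + 1) else q := by
    intro t ht
    rw [if_pos ht]
    split_ifs with h
    · have := κ.sizeUpTo_strict_mono h
      omega
    · have := κ.sizeUpTo_le t
      omega
  have key := sum_nestAt_firstBlock α j b (p := p) (q := q) (N := κ.length)
    (v := fun t => if t ≤ κ.length then p + κ.sizeUpTo t else q) hv (by simp) (by simp)
  have himg : (Finset.range (κ.length + 1)).image
      (fun t => if t ≤ κ.length then p + κ.sizeUpTo t else q) =
      (Finset.range (κ.length + 1)).image (fun t => p + κ.sizeUpTo t) :=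
    Finset.image_congr fun t ht => by
      rw [Finset.coe_range, Set.mem_Iio] at ht
      exact if_pos (by omega)
  rw [himg] at key
  rw [key]
  have h1 : ∀ t : Fin (κ.length + 1), (t : ℕ) ≤ κ.length := fun t => by omega
  have h2 : ∀ t : Fin κ.length, (t : ℕ) ≤ κ.length := fun t => by omega
  have h3 : ∀ t : Fin κ.length, (t : ℕ) + 1 ≤ κ.length := fun t => by omega
  simp only [h1, h2, h3, if_true, le_refl, Composition.sizeUpTo_length]

theorem nestedSum_of_le (b : ℕ → B) {p q : ℕ} (hqp : q ≤ p) : nestedSum α j b p q = 1 := by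
  have : blockMins p q = {fun s => s} := by
    ext f
    rw [mem_blockMins, Finset.mem_singleton]
    constructor
    · intro h
      funext s
      exact h.outside s (by omega)
    · rintro rfl
      exact ⟨fun _ _ => rfl, fun _ h _ => h, fun _ => le_rfl, fun _ => rfl,
        fun _ _ h h' => absurd (h.trans h') (lt_irrefl _)⟩
  rw [nestedSum, this, Finset.sum_singleton, nestAt_of_not]
  omega

theorem nestedSum_congr {b b' : ℕ → B} {p q : ℕ} (h : ∀ s, p ≤ s → s < q → b s = b' s) :
    nestedSum α j b p q = nestedSum α j b' p q := by
  induction hd : q - p using Nat.strong_induction_on generalizing p q with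
  | _ d ih =>
    rcases lt_or_ge p q with hpq | hpq
    · rw [nestedSum_eq_sum_composition α j b hpq, nestedSum_eq_sum_composition α j b' hpq]
      refine Finset.sum_congr rfl fun k hk => Finset.sum_congr rfl fun κ _ => ?_
      rw [Finset.mem_range] at hk
      congr 2
      · funext t
        have h1 := κ.sizeUpTo_le (t + 1)
        have h2 := κ.sizeUpTo_strict_mono t.2
        rw [h _ (by omega) (by omega), ih _ _ (fun s hs hs' => h s (by omega) (by omega)) rfl]
        omega
      · exact h _ (by omega) (by omega)
      · exact ih _ (by omega) (fun s hs hs' => h s (by omega) (by omega)) rfl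
    · rw [nestedSum_of_le α j b hpq, nestedSum_of_le α j b' hpq]

/-- The last coefficient always sits at the far right of the tail. Factoring it out is needed
because the moment-cumulant formula has no coefficient after its last letter. -/
theorem nestedSum_succ_eq_mul (b : ℕ → B) {p m : ℕ} (hpm : p ≤ m) :
    nestedSum α j b p (m + 1) = nestedSum α j (Function.update b m 1) p (m + 1) * b m := by
  induction hd : m - p using Nat.strong_induction_on generalizing p with
  | _ d ih =>
    rw [nestedSum_eq_sum_composition α j b (by omega),
      nestedSum_eq_sum_composition α j (Function.update b m 1) (by omega), Finset.sum_mul]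
    refine Finset.sum_congr rfl fun k hk => ?_
    rw [Finset.sum_mul]
    refine Finset.sum_congr rfl fun κ _ => ?_
    rw [Finset.mem_range] at hk
    rw [mul_assoc]
    congr 1
    · congr 1
      funext t
      have h1 := κ.sizeUpTo_le (t + 1)
      have h2 := κ.sizeUpTo_strict_mono t.2
      rw [Function.update_of_ne (by omega)]
      congr 1
      exact nestedSum_congr α j fun s hs hs' => by rw [Function.update_of_ne (by omega)]
    · rcases (show p + k ≤ m by omega).eq_or_lt with h | h
      · rw [h, nestedSum_of_le α j _ le_rfl, nestedSum_of_le α j _ le_rfl, Function.update_self, mul_one, mul_one, one_mul]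
      · rw [Function.update_of_ne (by omega), ih _ (by omega) (by omega) rfl, mul_assoc]

end Recursion

/-! ### Noncrossing `Finpartition`s correspond to block-minimum maps. -/

section LeastElements

variable {m : ℕ}

/-- The least element of the block of a point. -/
def Finpartition.least (π : Finpartition (Finset.univ : Finset (Fin (m + 1)))) (i : Fin (m + 1)) :
    Fin (m + 1) :=
  (π.part i).min' ⟨i, π.mem_part (Finset.mem_univ _)⟩

theorem Finpartition.least_mem (π : Finpartition (Finset.univ : Finset (Fin (m + 1))))
    (i : Fin (m + 1)) : π.least i ∈ π.part i := Finset.min'_mem _ _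

theorem Finpartition.least_le (π : Finpartition (Finset.univ : Finset (Fin (m + 1))))
    {i t : Fin (m + 1)} (h : t ∈ π.part i) : π.least i ≤ t := Finset.min'_le _ _ h

theorem Finpartition.part_eq_part_of_mem (π : Finpartition (Finset.univ : Finset (Fin (m + 1))))
    {i t : Fin (m + 1)} (h : t ∈ π.part i) : π.part t = π.part i :=
  (π.mem_part_iff_part_eq_part (Finset.mem_univ _) (Finset.mem_univ _)).1 h

theorem Finpartition.least_eq_least_iff (π : Finpartition (Finset.univ : Finset (Fin (m + 1))))
    {i t : Fin (m + 1)} : π.least i = π.least t ↔ π.part i = π.part t := by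
  constructor
  · intro h
    rw [← π.part_eq_part_of_mem (π.least_mem i), h, π.part_eq_part_of_mem (π.least_mem t)]
  · intro h
    unfold least
    simp only [h]

theorem Finpartition.least_eq_self_iff (π : Finpartition (Finset.univ : Finset (Fin (m + 1))))
    {i : Fin (m + 1)} : π.least i = i ↔ ∀ t ∈ π.part i, i ≤ t := by
  constructor
  · intro h t ht
    rw [← h]
    exact π.least_le ht
  · intro h
    exact le_antisymm (π.least_le (π.mem_part (Finset.mem_univ _))) (h _ (π.least_mem i))

/-- The map on `ℕ` sending each point of `[p, p + m + 1)` to the least element of its block. -/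
def Finpartition.leastFrom (p : ℕ) (π : Finpartition (Finset.univ : Finset (Fin (m + 1)))) (s : ℕ) :
    ℕ :=
  if h : p ≤ s ∧ s < p + (m + 1) then p + π.least ⟨s - p, by omega⟩ else s

theorem Finpartition.leastFrom_add (p : ℕ) (π : Finpartition (Finset.univ : Finset (Fin (m + 1))))
    (i : Fin (m + 1)) : π.leastFrom p (p + i) = p + π.least i := by
  rw [leastFrom, dif_pos (by omega)]
  congr 3
  exact Fin.ext (by simp)

theorem Finpartition.leastFrom_of_not (p : ℕ)
    (π : Finpartition (Finset.univ : Finset (Fin (m + 1)))) {s : ℕ}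
    (h : ¬ (p ≤ s ∧ s < p + (m + 1))) : π.leastFrom p s = s := dif_neg h

theorem exists_fin_of_mem {p s : ℕ} (h : p ≤ s ∧ s < p + (m + 1)) :
    ∃ i : Fin (m + 1), s = p + i :=
  ⟨⟨s - p, by omega⟩, by simp; omega⟩

theorem IsNoncrossing.isBlockMin {π : Finpartition (Finset.univ : Finset (Fin (m + 1)))}
    (hπ : IsNoncrossing π) (p : ℕ) : IsBlockMin p (p + (m + 1)) (π.leastFrom p) := by
  have hle : ∀ i, π.least i ≤ i := fun i => π.least_le (π.mem_part (Finset.mem_univ _))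
  have hidem : ∀ i, π.least (π.least i) = π.least i := fun i =>
    π.least_eq_least_iff.2 (π.part_eq_part_of_mem (π.least_mem i))
  refine ⟨fun s hs => π.leastFrom_of_not p hs, ?_, ?_, ?_, ?_⟩
  · intro s h1 h2
    obtain ⟨i, rfl⟩ := exists_fin_of_mem ⟨h1, h2⟩
    rw [π.leastFrom_add]
    omega
  · intro s
    by_cases h : p ≤ s ∧ s < p + (m + 1)
    · obtain ⟨i, rfl⟩ := exists_fin_of_mem h
      rw [π.leastFrom_add]
      have : (π.least i : ℕ) ≤ i := hle i
      omega
    · rw [π.leastFrom_of_not p h]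
  · intro s
    by_cases h : p ≤ s ∧ s < p + (m + 1)
    · obtain ⟨i, rfl⟩ := exists_fin_of_mem h
      rw [π.leastFrom_add, π.leastFrom_add, hidem]
    · rw [π.leastFrom_of_not p h, π.leastFrom_of_not p h]
  · intro s t h1 h2
    by_cases h : p ≤ s ∧ s < p + (m + 1)
    · obtain ⟨i, rfl⟩ := exists_fin_of_mem h
      rw [π.leastFrom_add] at h1 ⊢
      obtain ⟨u, rfl⟩ := exists_fin_of_mem (m := m) (p := p) (s := t) (by omega)
      rw [π.leastFrom_add]
      by_contra hlt
      have h3 : π.least u < π.least i := Fin.lt_def.2 (by omega)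
      -- If the claimed inequality failed, the two minima and the two points would form a crossing.
      have h4 := hπ (π.least u) (π.least i) u i h3 (Fin.lt_def.2 (by omega))
        (Fin.lt_def.2 (by omega)) (π.part_eq_part_of_mem (π.least_mem u))
        (π.part_eq_part_of_mem (π.least_mem i))
      rw [← π.least_eq_least_iff, hidem, hidem] at h4
      exact h3.ne h4
    · rw [π.leastFrom_of_not p h] at h1
      omega

theorem Finpartition.leastFrom_injective (p : ℕ) : Function.Injective
    (fun π : Finpartition (Finset.univ : Finset (Fin (m + 1))) => π.leastFrom p) := by
  intro π π' h
  have h1 : ∀ i, π.least i = π'.least i := fun i => by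
    have := congrFun h (p + i)
    simp only [Finpartition.leastFrom_add] at this
    exact Fin.ext (by omega)
  have h2 : ∀ i, π.part i = π'.part i := fun i => by
    ext t
    rw [π.mem_part_iff_part_eq_part (Finset.mem_univ _) (Finset.mem_univ _),
      π'.mem_part_iff_part_eq_part (Finset.mem_univ _) (Finset.mem_univ _),
      ← π.least_eq_least_iff, ← π'.least_eq_least_iff, h1, h1]
  ext V
  constructor
  · intro hV
    obtain ⟨i, hi⟩ := π.nonempty_of_mem_parts hV
    rw [← π.part_eq_of_mem hV hi, h2]
    exact π'.part_mem.2 (Finset.mem_univ _)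
  · intro hV
    obtain ⟨i, hi⟩ := π'.nonempty_of_mem_parts hV
    rw [← π'.part_eq_of_mem hV hi, ← h2]
    exact π.part_mem.2 (Finset.mem_univ _)

theorem IsBlockMin.exists_finpartition {p : ℕ} {f : ℕ → ℕ} (hf : IsBlockMin p (p + (m + 1)) f) :
    ∃ π : Finpartition (Finset.univ : Finset (Fin (m + 1))), IsNoncrossing π ∧
      π.leastFrom p = f := by
  classical
  -- The blocks are the fibres of f. By idempotence each minimum lies in its own fibre, and f s ≤ s
  -- makes it the least point there.
  let r : Setoid (Fin (m + 1)) := Setoid.ker fun i : Fin (m + 1) => f (p + i)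
  have hr : ∀ i t : Fin (m + 1), t ∈ (Finpartition.ofSetoid r).part i ↔ f (p + i) = f (p + t) := by
    intro i t
    rw [Finpartition.mem_part_ofSetoid_iff_rel]
    rfl
  refine ⟨Finpartition.ofSetoid r, ?_, ?_⟩
  · intro i t u w h1 h2 h3 h4 h5
    have e1 : f (p + u) = f (p + i) := by
      rw [← hr u i, h4.symm]
      exact Finpartition.mem_part _ (Finset.mem_univ _)
    have e2 : f (p + w) = f (p + t) := by
      rw [← hr w t, h5.symm]
      exact Finpartition.mem_part _ (Finset.mem_univ _)
    have e3 : f (p + t) = f (p + i) → (Finpartition.ofSetoid r).part i =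
        (Finpartition.ofSetoid r).part t := fun h =>
      Finpartition.part_eq_part_of_mem _ ((hr t i).2 h)
    rw [Fin.lt_def] at h1 h2 h3
    refine (e3 ?_)
    have l1 := hf.le (p + i)
    have l2 := hf.le (p + t)
    -- For i < t < u < w with i, u and t, w paired, noncrossing applied to (w, u) and to (u, t)
    -- gives the two inequalities between the minima.
    refine le_antisymm ?_ ?_
    · have := hf.noncrossing (p + w) (p + u) (by omega) (by omega)
      omega
    · have := hf.noncrossing (p + u) (p + t) (by omega) (by omega)
      omega
  · funext s
    by_cases h : p ≤ s ∧ s < p + (m + 1)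
    · obtain ⟨i, rfl⟩ := exists_fin_of_mem h
      rw [Finpartition.leastFrom_add]
      have h1 := hf.mem_Ico h.1 h.2
      obtain ⟨t, ht⟩ := exists_fin_of_mem h1
      rw [ht]
      congr 2
      refine le_antisymm (Finpartition.least_le _ ?_) ?_
      · rw [hr, ← hf.idem, ht]
      · have := (hr _ _).1 ((Finpartition.ofSetoid r).least_mem i)
        have h2 := hf.le (p + (Finpartition.ofSetoid r).least i)
        rw [Fin.le_def]
        omega
    · rw [Finpartition.leastFrom_of_not _ _ h, hf.outside s h]

end LeastElements

/-! ### Removing blocks from the word computes the nested evaluation. -/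

section Absorb

variable {I B : Type*} [Ring B] [Algebra ℂ B]
  (α : (k : ℕ) → (Fin (k + 1) → I) → MultilinearMap ℂ (fun _ : Fin k => B) B)

theorem blockValue_eq_blockEval (p : ℕ) (J : ℕ → I) {n : ℕ} {V : Finset (Fin n)} (hV : V.Nonempty)
    {W : Finset ℕ} (hW : W = V.image (fun i : Fin n => p + (i : ℕ))) (c : Fin (n + 1) → B)
    (g : ℕ → B) (hg : ∀ i ∈ V, c i.succ = g (p + i)) :
    blockValue (fun k j b => α k j b) (fun i : Fin n => J (p + i)) V c = blockEval α J W g := by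
  have hpos := hV.card_pos
  have h : V.card = V.card - 1 + 1 := by omega
  have hinj : Function.Injective (fun i : Fin n => p + (i : ℕ)) := fun i i' e => by
    have e' : p + (i : ℕ) = p + i' := e
    exact Fin.ext (by omega)
  have hc : W.card = V.card - 1 + 1 := by
    rw [hW, Finset.card_image_of_injective _ hinj, ← h]
  have huniq := Finset.orderEmbOfFin_unique hc
    (f := fun t => p + (V.orderEmbOfFin h t : ℕ))
    (fun t => by
      rw [hW]
      exact Finset.mem_image_of_mem _ (V.orderEmbOfFin_mem h t))
    (fun s t hst => by
      have : V.orderEmbOfFin h s < V.orderEmbOfFin h t := (V.orderEmbOfFin h).strictMono hst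
      simpa using this)
  rw [blockEval_of_card α J hc, ← huniq]
  unfold blockValue
  rw [dif_pos h]
  congr 2
  · funext t
    exact hg _ (V.orderEmbOfFin_mem h _)
  · exact hg _ (V.orderEmbOfFin_mem h _)

/-- Invariant of the removal, which runs from right to left: once the positions from k on have been
treated, each coefficient to the left of such a position has absorbed the complete evaluation
starting there, and earlier coefficients are untouched. When a minimum is reached, the coefficients
to the right of its block's points therefore already contain the values of the gaps. -/
theorem absorbBlocks_drop (p : ℕ) (J : ℕ → I) (b : ℕ → B) {m : ℕ}
    (π : Finpartition (Finset.univ : Finset (Fin (m + 1)))) (c : Fin (m + 2) → B)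
    (hc : ∀ i : Fin (m + 1), c i.succ = b (p + i)) (k : ℕ) (hk : k ≤ m + 1) (i : Fin (m + 2)) :
    absorbBlocks (fun k j b => α k j b) (fun i : Fin (m + 1) => J (p + i)) π
        ((List.finRange (m + 1)).drop k) c i =
      if k ≤ i then c i * nestAt α J b (π.leastFrom p) (p + (m + 1)) (p + i) else c i := by
  induction hd : m + 1 - k generalizing k i with
  | zero =>
    obtain rfl : k = m + 1 := by omega
    rw [List.drop_of_length_le (by simp)]
    simp only [absorbBlocks, List.foldr_nil]
    split_ifs with h
    · rw [nestAt_of_not _ _ _ (by omega), mul_one]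
    · rfl
  | succ d ih =>
    have hkm : k < m + 1 := by omega
    have hdrop : (List.finRange (m + 1)).drop k =
        (⟨k, hkm⟩ : Fin (m + 1)) :: (List.finRange (m + 1)).drop (k + 1) := by
      rw [List.drop_eq_getElem_cons (by simpa using hkm)]
      simp
    have ih' := fun i => ih (k + 1) (by omega) i (by omega)
    set s : Fin (m + 1) := ⟨k, hkm⟩ with hs
    rw [hdrop]
    have hstep : absorbBlocks (fun k j b => α k j b) (fun i : Fin (m + 1) => J (p + i)) π
        (s :: (List.finRange (m + 1)).drop (k + 1)) c =
        if ∀ t ∈ π.part s, s ≤ t then absorbBlock (fun k j b => α k j b)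
          (fun i : Fin (m + 1) => J (p + i)) (π.part s) s
          (absorbBlocks (fun k j b => α k j b) (fun i : Fin (m + 1) => J (p + i)) π
            ((List.finRange (m + 1)).drop (k + 1)) c)
        else absorbBlocks (fun k j b => α k j b) (fun i : Fin (m + 1) => J (p + i)) π
          ((List.finRange (m + 1)).drop (k + 1)) c := rfl
    rw [hstep]
    have hfs : π.leastFrom p (p + k) = p + k ↔ ∀ t ∈ π.part s, s ≤ t := by
      rw [← π.least_eq_self_iff]
      have := π.leastFrom_add p s
      have hsk : (s : ℕ) = k := rfl
      rw [hsk] at this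
      rw [this, Fin.ext_iff]
      omega
    by_cases hik : (i : ℕ) = k
    · obtain rfl : i = s.castSucc := Fin.ext hik
      have hsk : ((s.castSucc : Fin (m + 2)) : ℕ) = k := rfl
      rw [if_pos hsk.ge, hsk]
      split_ifs with hmin
      · rw [absorbBlock, Function.update_self, ih', if_neg (by omega),
          nestAt_of_min α J b (by omega) (hfs.2 hmin)]
        congr 1
        refine blockValue_eq_blockEval α p J ⟨s, π.mem_part (Finset.mem_univ _)⟩ ?_ _ _ ?_
        · ext t
          rw [Finset.mem_filter, Finset.mem_Ico, Finset.mem_image]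
          constructor
          · rintro ⟨⟨h1, h2⟩, h3⟩
            obtain ⟨u, rfl⟩ := exists_fin_of_mem (m := m) (p := p) (s := t) (by omega)
            rw [π.leastFrom_add] at h3
            refine ⟨u, ?_, rfl⟩
            rw [π.mem_part_iff_part_eq_part (Finset.mem_univ _) (Finset.mem_univ _),
              ← π.least_eq_least_iff, π.least_eq_self_iff.2 hmin]
            exact Fin.ext (show (π.least u : ℕ) = k by omega)
          · rintro ⟨u, hu, rfl⟩
            have h1 : k ≤ (u : ℕ) := hmin u hu
            rw [π.leastFrom_add, π.least_eq_least_iff.2 (π.part_eq_part_of_mem hu),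
              π.least_eq_self_iff.2 hmin]
            exact ⟨⟨by omega, by omega⟩, rfl⟩
        · intro u hu
          have h1 : k ≤ (u : ℕ) := hmin u hu
          rw [ih', if_pos (by simp; omega), hc]
          rfl
      · rw [ih', if_neg (by omega), nestAt_of_not, mul_one]
        exact fun h => hmin (hfs.1 h.2)
    · have hne : i ≠ s.castSucc := fun e => hik (by rw [e]; rfl)
      have : (if ∀ t ∈ π.part s, s ≤ t then absorbBlock (fun k j b => α k j b)
          (fun i : Fin (m + 1) => J (p + i)) (π.part s) s
          (absorbBlocks (fun k j b => α k j b) (fun i : Fin (m + 1) => J (p + i)) π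
            ((List.finRange (m + 1)).drop (k + 1)) c)
        else absorbBlocks (fun k j b => α k j b) (fun i : Fin (m + 1) => J (p + i)) π
          ((List.finRange (m + 1)).drop (k + 1)) c) i =
          absorbBlocks (fun k j b => α k j b) (fun i : Fin (m + 1) => J (p + i)) π
          ((List.finRange (m + 1)).drop (k + 1)) c i := by
        split_ifs
        · rw [absorbBlock, Function.update_of_ne hne]
        · rfl
      rw [this, ih']
      have : k + 1 ≤ (i : ℕ) ↔ k ≤ i := by omega
      simp only [this]

open Classical in
/-- The sum over noncrossing partitions in the moment-cumulant formula. -/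
theorem sum_nestedValue (p : ℕ) (J : ℕ → I) (b : ℕ → B) {m : ℕ} (hb : b (p + m) = 1) :
    ∑ π : Finpartition (Finset.univ : Finset (Fin (m + 1))) with IsNoncrossing π,
      nestedValue (fun k j b => α k j b) (fun i : Fin (m + 1) => J (p + i)) π
        (fun i : Fin m => b (p + i)) = nestedSum α J b p (p + (m + 1)) := by
  rw [nestedSum]
  refine Finset.sum_bij (fun π _ => π.leastFrom p) ?_ ?_ ?_ ?_
  · intro π hπ
    exact mem_blockMins.2 ((Finset.mem_filter.1 hπ).2.isBlockMin p)
  · intro π _ π' _ h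
    exact Finpartition.leastFrom_injective p h
  · intro f hf
    obtain ⟨π, hπ, rfl⟩ := (mem_blockMins.1 hf).exists_finpartition
    exact ⟨π, Finset.mem_filter.2 ⟨Finset.mem_univ _, hπ⟩, rfl⟩
  · intro π _
    have := absorbBlocks_drop α p J b π
      (Fin.cons 1 (Fin.snoc (fun i : Fin m => b (p + i)) 1 : Fin (m + 1) → B)) ?_ 0 (Nat.zero_le _) 0
    · rw [List.drop_zero] at this
      rw [nestedValue, this]
      simp
    · intro i
      rw [Fin.cons_succ]
      induction i using Fin.lastCases with
      | last => simp [hb]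
      | cast i => simp

end Absorb

/-! ### The one-block partition and the recursive definition of cumulants. -/

section Truncation

variable {m : ℕ}

theorem Finpartition.part_top (i : Fin (m + 1)) :
    (⊤ : Finpartition (Finset.univ : Finset (Fin (m + 1)))).part i = Finset.univ := by
  have h := Finpartition.part_mem (⊤ : Finpartition (Finset.univ : Finset (Fin (m + 1))))
    |>.2 (Finset.mem_univ i)
  exact Finset.mem_singleton.1 (Finpartition.parts_top_subset _ h)

theorem Finpartition.eq_top_of_part_eq_univ
    {π : Finpartition (Finset.univ : Finset (Fin (m + 1)))} {i : Fin (m + 1)}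
    (h : π.part i = Finset.univ) : π = ⊤ := by
  refine eq_top_iff.2 fun V _ => ⟨π.part i, π.part_mem.2 (Finset.mem_univ _), ?_⟩
  rw [h]
  exact Finset.subset_univ V

theorem isNoncrossing_top : IsNoncrossing (⊤ : Finpartition (Finset.univ : Finset (Fin (m + 1)))) :=
  fun p q _ _ _ _ _ _ _ => by rw [Finpartition.part_top, Finpartition.part_top]

/-- A partition with more than one block has blocks of at most m points, which call only for
cumulants of fewer than m arguments. This removes the cutoff in the recursive definition. -/
theorem nestedValue_congr {I B : Type*} [Ring B]
    {α α' : (k : ℕ) → (Fin (k + 1) → I) → (Fin k → B) → B} (h : ∀ k < m, α k = α' k)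
    (j : Fin (m + 1) → I) {π : Finpartition (Finset.univ : Finset (Fin (m + 1)))} (hπ : π ≠ ⊤)
    (b : Fin m → B) : nestedValue α j π b = nestedValue α' j π b := by
  have hblock : ∀ s c, blockValue α j (π.part s) c = blockValue α' j (π.part s) c := by
    intro s c
    have hlt : (π.part s).card < m + 1 := by
      have h1 : π.part s ⊂ Finset.univ :=
        Finset.ssubset_univ_iff.2 fun h => hπ (Finpartition.eq_top_of_part_eq_univ h)
      simpa using Finset.card_lt_card h1
    have hpos : 0 < (π.part s).card := Finset.card_pos.2 ⟨s, π.mem_part (Finset.mem_univ _)⟩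
    unfold blockValue
    rw [h _ (by omega)]
  have : ∀ l c, absorbBlocks α j π l c = absorbBlocks α' j π l c := by
    intro l c
    simp only [absorbBlocks, absorbBlock, hblock]
  exact congrFun (this _ _) 0

theorem nestedValue_top {I B : Type*} [Ring B] [Algebra ℂ B]
    (α : (k : ℕ) → (Fin (k + 1) → I) → MultilinearMap ℂ (fun _ : Fin k => B) B) (p : ℕ) (J : ℕ → I)
    (b : ℕ → B) :
    nestedValue (fun k j b => α k j b) (fun i : Fin (m + 1) => J (p + i)) ⊤
      (fun i : Fin m => b (p + i)) =
    α m (fun i => J (p + i)) (fun i => b (p + i)) := by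
  have hc : ∀ i : Fin (m + 1), (Fin.cons 1 (Fin.snoc (fun i : Fin m => b (p + i)) 1 :
      Fin (m + 1) → B) : Fin (m + 2) → B) i.succ = Function.update b (p + m) 1 (p + i) := by
    intro i
    rw [Fin.cons_succ]
    induction i using Fin.lastCases with
    | last => simp
    | cast i =>
      rw [Fin.snoc_castSucc, Function.update_of_ne]
      · rfl
      · simp; omega
  -- The value 1 at p + m is the outer right coefficient of the word, which does not occur in the
  -- cumulant.
  have h := absorbBlocks_drop α p J (Function.update b (p + m) 1) ⊤ _ hc 0 (Nat.zero_le _) 0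
  have hleast : ∀ i : Fin (m + 1),
      (⊤ : Finpartition (Finset.univ : Finset (Fin (m + 1)))).least i = 0 := fun i =>
    le_antisymm (Finpartition.least_le _ (by rw [Finpartition.part_top]; exact Finset.mem_univ _))
      (Fin.zero_le _)
  have hfrom : ∀ i : Fin (m + 1),
      (⊤ : Finpartition (Finset.univ : Finset (Fin (m + 1)))).leastFrom p (p + i) = p := fun i => by
    rw [Finpartition.leastFrom_add, hleast]
    rfl
  have hV : (Finset.Ico p (p + (m + 1))).filter
      (fun s => (⊤ : Finpartition (Finset.univ : Finset (Fin (m + 1)))).leastFrom p s = p) =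
      (Finset.range (m + 1)).image (fun t => p + t) := by
    ext s
    rw [Finset.mem_filter, Finset.mem_Ico, Finset.mem_image]
    constructor
    · rintro ⟨h1, _⟩
      exact ⟨s - p, Finset.mem_range.2 (by omega), by omega⟩
    · rintro ⟨t, ht, rfl⟩
      rw [Finset.mem_range] at ht
      exact ⟨by omega, hfrom ⟨t, ht⟩⟩
  have hone : ∀ t : ℕ, t ≤ m → nestAt α J (Function.update b (p + m) 1)
      ((⊤ : Finpartition (Finset.univ : Finset (Fin (m + 1)))).leastFrom p) (p + (m + 1))
      (p + t + 1) = 1 := by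
    intro t ht
    refine nestAt_of_not _ _ _ ?_
    rintro ⟨h1, h2⟩
    have := hfrom ⟨t + 1, by omega⟩
    simp only [← add_assoc] at this
    omega
  rw [List.drop_zero, if_pos (Nat.zero_le _), Fin.cons_zero, one_mul] at h
  rw [nestedValue, h]
  have h00 : p + ((0 : Fin (m + 2)) : ℕ) = p := rfl
  rw [h00, nestAt_of_min α J _ (s := p) (by omega) (hfrom 0), hV,
    blockEval_image α J (fun t _ => by omega), hone m le_rfl, Function.update_self, mul_one, mul_one]
  congr 1
  funext t
  rw [hone t t.2.le, mul_one, Function.update_of_ne]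
  omega

end Truncation

/-! ### Moment-cumulant formula and first-block recursion for moments. -/

namespace StarProbSpace

variable {B A : Type*} [Ring B] [StarRing B] [Algebra ℂ B] [StarModule ℂ B]
    [Ring A] [StarRing A] [Algebra ℂ A] [StarModule ℂ A] (P : StarProbSpace B A)

theorem E_one : P.E 1 = 1 := by
  have := P.E_incl 1
  rwa [map_one] at this

theorem E_mul_incl (y : A) (b : B) : P.E (y * P.incl b) = P.E y * b := by
  have := P.E_bimod 1 b y
  rwa [map_one, one_mul, one_mul] at this

theorem word_apply {n : ℕ} (x : Fin n → A) (b : Fin n → B) :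
    P.word x b = (List.ofFn fun i => x i * P.incl (b i)).prod := by
  simp [word]

theorem E_word_succ {m : ℕ} (x : Fin (m + 1) → A) (b : Fin (m + 1) → B) :
    P.E (P.word x b) = P.moment x (fun i => b i.castSucc) * b (Fin.last m) := by
  rw [word_apply, List.ofFn_succ', List.concat_eq_append, List.prod_append, List.prod_singleton,
    ← mul_assoc, E_mul_incl, ← word_apply P (fun i => x i.castSucc) (fun i => b i.castSucc)]
  rfl

open Classical in
/-- The moment-cumulant formula. -/
theorem sum_nestedValue_cumulant {I : Type*} (x : I → A) (p m : ℕ) (J : ℕ → I) (b : ℕ → B) :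
    ∑ π : Finpartition (Finset.univ : Finset (Fin (m + 1))) with IsNoncrossing π,
      nestedValue (fun k j b => P.cumulant x k j b) (fun i : Fin (m + 1) => J (p + i)) π
        (fun i : Fin m => b (p + i)) =
      P.moment (fun i : Fin (m + 1) => x (J (p + i))) (fun i : Fin m => b (p + i)) := by
  have hsplit : (Finset.univ.filter fun π : Finpartition (Finset.univ : Finset (Fin (m + 1))) =>
      IsNoncrossing π) = insert ⊤ (Finset.univ.filter fun π => IsNoncrossing π ∧ π ≠ ⊤) := by
    ext π
    simp only [Finset.mem_filter, Finset.mem_univ, true_and, Finset.mem_insert]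
    by_cases h : π = ⊤
    · subst h
      simp [isNoncrossing_top]
    · simp [h]
  rw [hsplit, Finset.sum_insert (by simp), nestedValue_top]
  have hcum : P.cumulant x m (fun i => J (p + i)) (fun i => b (p + i)) =
      P.cumulantFun x m (fun i => J (p + i)) (fun i => b (p + i)) := rfl
  rw [hcum, cumulantFun.eq_def]
  have : ∀ π ∈ Finset.univ.filter
      (fun π : Finpartition (Finset.univ : Finset (Fin (m + 1))) => IsNoncrossing π ∧ π ≠ ⊤),
      nestedValue (fun k j' b' => if _h : k < m then P.cumulantFun x k j' b' else 0)
        (fun i : Fin (m + 1) => J (p + i)) π (fun i : Fin m => b (p + i)) =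
      nestedValue (fun k j b => P.cumulant x k j b)
        (fun i : Fin (m + 1) => J (p + i)) π (fun i : Fin m => b (p + i)) := by
    intro π hπ
    refine nestedValue_congr ?_ _ (Finset.mem_filter.1 hπ).2.2 _
    intro k hk
    funext j' b'
    rw [dif_pos hk]
    rfl
  simp only
  rw [Finset.sum_congr rfl this, sub_add_cancel]

/-- The moment `E(x_{J p} b_p ⋯ x_{J (p + n - 1)} b_{p + n - 1})`. -/
def wordMoment {I : Type*} (x : I → A) (J : ℕ → I) (b : ℕ → B) (p n : ℕ) : B :=
  P.E (P.word (fun i : Fin n => x (J (p + i))) (fun i : Fin n => b (p + i)))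

theorem wordMoment_zero {I : Type*} (x : I → A) (J : ℕ → I) (b : ℕ → B) (p : ℕ) :
    P.wordMoment x J b p 0 = 1 := by
  rw [wordMoment, word_apply, List.ofFn_zero, List.prod_nil, E_one]

/-- This is what turns the gap sums back into moments. The last coefficient is set to 1 to match the
moment-cumulant formula and restored on the right by the bimodule property of E. -/
theorem nestedSum_cumulant {I : Type*} (x : I → A) (J : ℕ → I) (b : ℕ → B) (p n : ℕ) :
    nestedSum (fun k j => P.cumulant x k j) J b p (p + n) = P.wordMoment x J b p n := by
  classical
  cases n with
  | zero => rw [wordMoment_zero, nestedSum_of_le _ _ _ (by omega)]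
  | succ m =>
    have h1 := sum_nestedValue (fun k j => P.cumulant x k j) p J (Function.update b (p + m) 1)
      (m := m) (Function.update_self _ _ _)
    have h2 := P.sum_nestedValue_cumulant x p m J (Function.update b (p + m) 1)
    have h3 : (fun i : Fin m => Function.update b (p + m) 1 (p + i)) = fun i : Fin m => b (p + i) := by
      funext i
      rw [Function.update_of_ne]
      omega
    rw [← add_assoc, nestedSum_succ_eq_mul _ _ _ (by omega), add_assoc, ← h1]
    refine (congrArg (· * b (p + m)) h2).trans ?_
    rw [h3, wordMoment, E_word_succ]
    rfl

/-- The first-block recursion for moments. -/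
theorem wordMoment_succ {I : Type*} (x : I → A) (J : ℕ → I) (b : ℕ → B) (p n : ℕ) (hn : 0 < n) :
    P.wordMoment x J b p n = ∑ k ∈ Finset.range n, ∑ κ : Composition k,
      P.cumulant x κ.length (fun t => J (p + κ.sizeUpTo t))
        (fun t => b (p + κ.sizeUpTo t) *
          P.wordMoment x J b (p + κ.sizeUpTo t + 1) (κ.blocksFun t - 1)) *
        (b (p + k) * P.wordMoment x J b (p + k + 1) (n - k - 1)) := by
  rw [← nestedSum_cumulant, nestedSum_eq_sum_composition _ _ _ (by omega), Nat.add_sub_cancel_left]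
  refine Finset.sum_congr rfl fun k hk => Finset.sum_congr rfl fun κ _ => ?_
  rw [Finset.mem_range] at hk
  simp only [← nestedSum_cumulant]
  congr 2
  · funext t
    have h1 := κ.sizeUpTo_succ' t
    have h2 := κ.one_le_blocksFun t
    congr 2
    omega
  · congr 1
    omega

end StarProbSpace

/-! ### Alternating indices and parity. -/

theorem altIdx_add (i : Fin 2) (k l : ℕ) : altIdx i (k + l) = altIdx (altIdx i k) l := by
  simp only [altIdx, Fin.ext_iff, Fin.val_add, Fin.ofNat]
  omega

theorem altIdx_congr (i : Fin 2) {k l : ℕ} (h : k % 2 = l % 2) : altIdx i k = altIdx i l := by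
  simp only [altIdx, Fin.ext_iff, Fin.val_add, Fin.ofNat]
  omega

theorem altIdx_add_one (i : Fin 2) (k : ℕ) : altIdx (i + 1) k = altIdx i (k + 1) := by
  simp only [altIdx, Fin.ext_iff, Fin.val_add, Fin.ofNat, Fin.val_one]
  omega

theorem altIdx_of_even (i : Fin 2) {k : ℕ} (h : Even k) : altIdx i k = i := by
  rw [Nat.even_iff] at h
  simp only [altIdx, Fin.ext_iff, Fin.val_add, Fin.ofNat]
  omega

theorem star_starPair_altIdx {A : Type*} [InvolutiveStar A] (a : A) (k : ℕ) :
    star (starPair a (altIdx 1 k)) = starPair a (altIdx 0 k) := by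
  rcases Nat.even_or_odd k with h | h
  · rw [altIdx_of_even _ h, altIdx_of_even _ h]
    simp [starPair]
  · have h1 : altIdx 0 k = 1 := by
      rw [altIdx_congr (l := 1) 0 (by rw [Nat.odd_iff] at h; omega)]
      rfl
    have h2 : altIdx 1 k = 0 := by
      rw [altIdx_congr (l := 1) 1 (by rw [Nat.odd_iff] at h; omega)]
      rfl
    rw [h1, h2]
    simp [starPair]

/-- Odd parts mean gaps of even length, so successive points of the block alternate in parity. This
makes the cumulant an alternating one. -/
theorem Composition.sizeUpTo_mod_two {k : ℕ} {κ : Composition k}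
    (h : ∀ t, Odd (κ.blocksFun t)) {t : ℕ} (ht : t ≤ κ.length) : κ.sizeUpTo t % 2 = t % 2 := by
  induction t with
  | zero => simp
  | succ t ih =>
    have h1 := κ.sizeUpTo_succ' ⟨t, ht⟩
    have h2 := Nat.odd_iff.1 (h ⟨t, ht⟩)
    have h3 := ih (by omega)
    simp only at h1
    omega

/-! ### Operations on function series, evaluated on windows of a sequence. -/

namespace MulSeries

variable {B : Type*} [Ring B] [Algebra ℂ B]

/-- Sequences indexed by ℕ let consecutive segments of the arguments be written as shifts; the
offset 0 matches the form of the shifted formulas. -/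
theorem ext_nat {X Y : MulSeries B}
    (h : ∀ (n : ℕ) (b : ℕ → B), X.term n (fun t => b (0 + t)) = Y.term n (fun t => b (0 + t))) :
    X = Y := by
  ext n c
  obtain ⟨b, rfl⟩ : ∃ b : ℕ → B, c = fun t : Fin n => b (0 + (t : ℕ)) := by
    refine ⟨fun s => if hs : s < n then c ⟨s, hs⟩ else 0, ?_⟩
    funext t
    simp only [zero_add]
    rw [dif_pos t.2]
  exact h n b

theorem add_term (X Y : MulSeries B) (n : ℕ) : (X + Y).term n = X.term n + Y.term n := rfl

theorem one_term_zero (c : Fin 0 → B) : (1 : MulSeries B).term 0 c = 1 := rfl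

theorem one_term_of_pos {n : ℕ} (hn : 0 < n) : (1 : MulSeries B).term n = 0 := by
  obtain ⟨m, rfl⟩ := Nat.exists_eq_succ_of_ne_zero hn.ne'
  rfl

theorem mul_term (X Y : MulSeries B) (n p : ℕ) (b : ℕ → B) :
    (X * Y).term n (fun t => b (p + t)) = ∑ k ∈ Finset.range (n + 1),
      X.term k (fun t => b (p + t)) * Y.term (n - k) (fun t => b (p + k + t)) := by
  rw [Finset.sum_range (fun k => X.term k (fun t => b (p + t)) *
    Y.term (n - k) (fun t => b (p + k + t)))]
  have h : (X * Y).term n = ∑ k : Fin (n + 1), (mulTerm_multilin X Y n k).toMultilinearMap := rfl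
  rw [h, sum_apply]
  refine Finset.sum_congr rfl fun k _ => ?_
  have h : (mulTerm_multilin X Y n k).toMultilinearMap (fun t => b (p + t)) =
    mulTerm X Y n k (fun t => b (p + t)) := rfl
  rw [h, mulTerm]
  simp only [add_assoc]

theorem idSeries_mul_term (X : MulSeries B) (n p : ℕ) (b : ℕ → B) :
    (idSeries * X).term n (fun t => b (p + t)) =
      if n = 0 then 0 else b p * X.term (n - 1) (fun t => b (p + 1 + t)) := by
  have h0 : ∀ k, k ≠ 1 → (idSeries : MulSeries B).term k = 0 := by
    intro k hk
    match k, hk with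
    | 0, _ => rfl
    | k + 2, _ => rfl
  rw [mul_term]
  split_ifs with hn
  · subst hn
    rw [zero_add, Finset.sum_range_one, h0 0 (by omega), zero_apply, zero_mul]
  · rw [Finset.sum_eq_single 1]
    · rfl
    · intro k _ hk
      rw [h0 k hk, zero_apply, zero_mul]
    · intro h
      rw [Finset.mem_range] at h
      omega

theorem comp_term {ι : Type*} (X : MulSeries B) (f : (p : ℕ) → Fin p → ι) (Y : ι → MulSeries B)
    (n p : ℕ) (b : ℕ → B) :
    (X.comp f Y).term n (fun t => b (p + t)) = ∑ κ : Composition n,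
      X.term κ.length fun t => (Y (f κ.length t)).term (κ.blocksFun t)
        fun s => b (p + κ.sizeUpTo t + s) := by
  have h : (X.comp f Y).term n =
    ∑ κ : Composition n, (compTerm_multilin X f Y κ).toMultilinearMap := rfl
  rw [h, sum_apply]
  refine Finset.sum_congr rfl fun κ _ => ?_
  have h : (compTerm_multilin X f Y κ).toMultilinearMap (fun t => b (p + t)) =
    compTerm X f Y κ (fun t => b (p + t)) := rfl
  rw [h, compTerm]
  simp only [add_assoc, Composition.coe_embedding]

end MulSeries

/-! ### R-diagonality and the functional equations of the moment series. -/

namespace StarProbSpace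

variable {B A : Type*} [Ring B] [StarRing B] [Algebra ℂ B] [StarModule ℂ B]
    [Ring A] [StarRing A] [Algebra ℂ A] [StarModule ℂ A] (P : StarProbSpace B A)

theorem moment_apply {m : ℕ} (x : Fin (m + 1) → A) (b : Fin m → B) :
    P.moment x b = P.E (P.word (fun i => x i.castSucc) b * x (Fin.last m)) := rfl

theorem star_word_mul {m : ℕ} (x : Fin (m + 1) → A) (b : Fin m → B) :
    star (P.word (fun i => x i.castSucc) b * x (Fin.last m)) =
      P.word (fun i => star (x i.castSucc.rev)) (fun i => star (b i.rev)) * star (x 0) := by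
  induction m with
  | zero => simp [word_apply]
  | succ m ih =>
    have h1 : P.word (fun i : Fin (m + 1) => x i.castSucc) b * x (Fin.last (m + 1)) =
        x 0 * P.incl (b 0) * (P.word (fun i : Fin m => x i.castSucc.succ) (fun i => b i.succ) *
          x (Fin.last m).succ) := by
      rw [word_apply, List.ofFn_succ, List.prod_cons, word_apply, mul_assoc]
      rfl
    have h2 := ih (fun i => x i.succ) (fun i => b i.succ)
    rw [h1, star_mul, h2, star_mul, word_apply, word_apply, List.ofFn_succ', List.concat_eq_append,
      List.prod_append, List.prod_singleton, ← map_star]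
    simp only [Fin.rev_castSucc, Fin.rev_last, Fin.succ_zero_eq_one]
    simp only [mul_assoc]

theorem star_moment {m : ℕ} (x : Fin (m + 1) → A) (b : Fin m → B) :
    star (P.moment x b) = P.moment (fun i => star (x i.rev)) (fun i => star (b i.rev)) := by
  rw [moment_apply, moment_apply, ← P.E_star, star_word_mul, Fin.rev_last]

/-- The odd alternating moments of an R-diagonal element vanish. -/
theorem IsRDiagonal.wordMoment_odd {P : StarProbSpace B A} {a : A} (ha : P.IsRDiagonal a)
    (i : Fin 2) (b : ℕ → B) (p : ℕ) {n : ℕ} (hn : Odd n) :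
    P.wordMoment (starPair a) (altIdx i) b p n = 0 := by
  obtain ⟨k, rfl⟩ := hn
  rw [wordMoment, E_word_succ]
  simp only [altIdx_add i p]
  have key : ∀ (i : Fin 2) (c : Fin (2 * k) → B),
      P.moment (fun t : Fin (2 * k + 1) => starPair a (altIdx i t)) c = 0 := by
    intro i c
    obtain rfl | rfl : i = 0 ∨ i = 1 := by omega
    · exact ha.1 k c
    -- The adjoint of an odd alternating word starting with a* is one starting with a, with the
    -- coefficients reversed and starred.
    · rw [← star_eq_zero, star_moment]
      have : (fun t : Fin (2 * k + 1) => star (starPair a (altIdx 1 (t.rev : ℕ)))) =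
          fun t : Fin (2 * k + 1) => starPair a (altIdx 0 t) := by
        funext t
        rw [star_starPair_altIdx, altIdx_congr (l := t) 0]
        rw [Fin.val_rev]
        omega
      rw [this]
      exact ha.1 k _
  rw [key, zero_mul]

theorem momentSeries_term {a : A} (ha : P.IsRDiagonal a) (i : Fin 2) (n p : ℕ) (b : ℕ → B) :
    (P.momentSeries a (altIdx i p)).term n (fun t => b (p + t)) =
      P.wordMoment (starPair a) (altIdx i) b p n := by
  unfold momentSeries
  by_cases hn : Even n
  · simp only [if_pos hn]
    simp only [wordMoment, altIdx_add i p]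
    rfl
  · simp only [if_neg hn]
    rw [ha.wordMoment_odd i b p (Nat.not_even_iff_odd.1 hn)]
    rfl

theorem idSeries_mul_momentSeries_term {a : A} (i : Fin 2) {n : ℕ} (hn : Even n) (p : ℕ) (b : ℕ → B) :
    (MulSeries.idSeries * P.momentSeries a i).term n (fun t => b (p + t)) = 0 := by
  rw [MulSeries.idSeries_mul_term]
  split_ifs with h
  · rfl
  · have : ¬ Even (n - 1) := by
      rw [Nat.even_iff] at *
      omega
    simp [momentSeries, this]

theorem idSeries_mul_momentSeries_term_of_pos {a : A} (ha : P.IsRDiagonal a) (i : Fin 2) {n : ℕ}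
    (hn : 0 < n) (p : ℕ) (b : ℕ → B) :
    (MulSeries.idSeries * P.momentSeries a (altIdx i (p + 1))).term n (fun t => b (p + t)) =
      b p * P.wordMoment (starPair a) (altIdx i) b (p + 1) (n - 1) := by
  rw [MulSeries.idSeries_mul_term, if_neg hn.ne', momentSeries_term P ha]

theorem cumulantSeries_term_of_odd (a : A) (i : Fin 2) {n : ℕ} (hn : Odd n) :
    (P.cumulantSeries a i).term n = P.cumulant (starPair a) n (fun k => altIdx i k) := if_pos hn

theorem cumulantSeries_term_of_even (a : A) (i : Fin 2) {n : ℕ} (hn : Even n) :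
    (P.cumulantSeries a i).term n = 0 := if_neg (Nat.not_odd_iff_even.2 hn)

/-- The functional equation of the moment series, evaluated in one degree. -/
theorem momentSeries_term_eq {a : A} (ha : P.IsRDiagonal a) (i : Fin 2) (n : ℕ) (b : ℕ → B) :
    (P.momentSeries a i).term n (fun t => b (0 + t)) =
      (1 : MulSeries B).term n (fun t => b (0 + t)) + ∑ k ∈ Finset.range (n + 1),
        (∑ κ : Composition k, (P.cumulantSeries a i).term κ.length fun t =>
          (MulSeries.idSeries * P.momentSeries a (altIdx (i + 1) t)).term (κ.blocksFun t)
            fun s => b (0 + κ.sizeUpTo t + s)) *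
          (MulSeries.idSeries * P.momentSeries a i).term (n - k) (fun s => b (0 + k + s)) := by
  -- The term k = n drops out because I M has no constant term; the remaining range is that of the
  -- first-block recursion.
  rw [Finset.sum_range_succ, Nat.sub_self, idSeries_mul_momentSeries_term P i Even.zero (0 + n) b,
    mul_zero, add_zero]
  rcases Nat.eq_zero_or_pos n with rfl | hn
  · have h := P.momentSeries_term ha i 0 0 b
    rw [altIdx_of_even i Even.zero, wordMoment_zero] at h
    rw [h, MulSeries.one_term_zero, Finset.range_zero, Finset.sum_empty, add_zero]
  · rw [MulSeries.one_term_of_pos hn, zero_apply, zero_add]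
    have h := P.momentSeries_term ha i n 0 b
    rw [altIdx_of_even i Even.zero] at h
    simp only [Finset.sum_mul]
    rcases Nat.even_or_odd n with hne | hno
    · rw [h, wordMoment_succ P _ _ _ _ _ hn]
      refine Finset.sum_congr rfl fun k hk => Finset.sum_congr rfl fun κ _ => ?_
      rw [Finset.mem_range] at hk
      by_cases hκ : ∀ t, Odd (κ.blocksFun t)
      · have hpar := fun t ht => Composition.sizeUpTo_mod_two hκ (t := t) ht
        have hlen := hpar κ.length le_rfl
        rw [Composition.sizeUpTo_length] at hlen
        rcases Nat.even_or_odd κ.length with hl | hl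
        -- Here the first block has an odd number of points, so in a word of even length the tail is
        -- odd and its moment vanishes, matching the zero even terms of the cumulant series.
        · rw [cumulantSeries_term_of_even P a i hl, ha.wordMoment_odd, mul_zero, mul_zero,
            zero_apply, zero_mul]
          rw [Nat.even_iff] at hl hne
          rw [Nat.odd_iff]
          omega
        · rw [cumulantSeries_term_of_odd P a i hl]
          have hi : altIdx i (0 + k + 1) = i := altIdx_of_even i (by
            rw [Nat.odd_iff] at hl
            rw [Nat.even_iff]
            omega)
          have htail := P.idSeries_mul_momentSeries_term_of_pos ha i (n := n - k) (by omega)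
            (0 + k) b
          rw [hi] at htail
          rw [htail]
          congr 1
          have hJ : (fun t : Fin (κ.length + 1) => altIdx i (0 + κ.sizeUpTo t)) =
              fun t : Fin (κ.length + 1) => altIdx i t := by
            funext t
            exact altIdx_congr i (by rw [zero_add, hpar t (by omega)])
          rw [hJ]
          congr 1
          funext t
          have hi : altIdx (i + 1) t = altIdx i (0 + κ.sizeUpTo t + 1) := by
            rw [altIdx_add_one]
            refine altIdx_congr i ?_
            have := hpar t (by omega)
            omega
          rw [hi, idSeries_mul_momentSeries_term_of_pos P ha i (hκ t).pos]
      -- An even part is a gap of odd length: its moment vanishes on one side, and the even term of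
      -- I M vanishes on the other.
      · obtain ⟨t, ht⟩ := not_forall.1 hκ
        rw [Nat.not_odd_iff_even] at ht
        have ht' := κ.one_le_blocksFun t
        rw [MultilinearMap.map_coord_zero _ t, MultilinearMap.map_coord_zero _ t, zero_mul, zero_mul]
        · rw [idSeries_mul_momentSeries_term P _ ht]
        · rw [ha.wordMoment_odd, mul_zero]
          rw [Nat.even_iff] at ht
          rw [Nat.odd_iff]
          omega
    -- In odd degree every term on the right vanishes too: with all parts odd, either the cumulant
    -- series is evaluated in even degree or the last factor I M is.
    · rw [h, ha.wordMoment_odd _ _ _ hno]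
      symm
      refine Finset.sum_eq_zero fun k hk => Finset.sum_eq_zero fun κ _ => ?_
      rw [Finset.mem_range] at hk
      by_cases hκ : ∀ t, Odd (κ.blocksFun t)
      · have hlen := Composition.sizeUpTo_mod_two hκ (t := κ.length) le_rfl
        rw [Composition.sizeUpTo_length] at hlen
        rcases Nat.even_or_odd κ.length with hl | hl
        · rw [cumulantSeries_term_of_even P a i hl, zero_apply, zero_mul]
        · rw [idSeries_mul_momentSeries_term P, mul_zero]
          rw [Nat.odd_iff] at hl hno
          rw [Nat.even_iff]
          omega
      · obtain ⟨t, ht⟩ := not_forall.1 hκ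
        rw [Nat.not_odd_iff_even] at ht
        rw [MultilinearMap.map_coord_zero _ t, zero_mul]
        rw [idSeries_mul_momentSeries_term P _ ht]

theorem momentSeries_eq {a : A} (ha : P.IsRDiagonal a) (i : Fin 2) :
    P.momentSeries a i = 1 +
      (P.cumulantSeries a i).comp (fun _ t => altIdx (i + 1) t)
          (fun i' => MulSeries.idSeries * P.momentSeries a i') *
        (MulSeries.idSeries * P.momentSeries a i) := by
  refine MulSeries.ext_nat fun n b => ?_
  rw [momentSeries_term_eq P ha, MulSeries.add_term, add_apply, MulSeries.mul_term]
  simp only [MulSeries.comp_term]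

end StarProbSpace

/-! ### Specialization to alternating arguments and formal power series. -/

/-- The sequence `b₁, b₂, b₁, b₂, …`. -/
def altSeq {B : Type*} (b₁ b₂ : B) (s : ℕ) : B := if Even s then b₁ else b₂

theorem altSeq_add_of_even {B : Type*} (b₁ b₂ : B) {p : ℕ} (hp : p % 2 = 0) (s : ℕ) :
    altSeq b₁ b₂ (p + s) = altSeq b₁ b₂ (0 + s) := by
  have : Even (p + s) ↔ Even (0 + s) := by
    rw [Nat.even_iff, Nat.even_iff]
    omega
  simp only [altSeq, this]

theorem altSeq_add_of_odd {B : Type*} (b₁ b₂ : B) {p : ℕ} (hp : p % 2 = 1) (s : ℕ) :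
    altSeq b₁ b₂ (p + s) = altSeq b₂ b₁ (0 + s) := by
  have : Even (p + s) ↔ ¬ Even (0 + s) := by
    rw [Nat.even_iff, Nat.even_iff]
    omega
  simp only [altSeq, this]
  split_ifs <;> rfl

theorem PowerSeries.coeff_monomial_one_mul {B : Type*} [Ring B] (b : B) (f : PowerSeries B) (n : ℕ) :
    PowerSeries.coeff n (PowerSeries.monomial 1 b * f) =
      if n = 0 then 0 else b * PowerSeries.coeff (n - 1) f := by
  rw [PowerSeries.coeff_mul]
  split_ifs with hn
  · subst hn
    simp [PowerSeries.coeff_monomial]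
  · rw [Finset.sum_eq_single (1, n - 1)]
    · rw [PowerSeries.coeff_monomial_same]
    · rintro ⟨k, l⟩ hkl hne
      rw [Finset.HasAntidiagonal.mem_antidiagonal] at hkl
      rw [PowerSeries.coeff_monomial, if_neg, zero_mul]
      rintro rfl
      exact hne (by simp only at hkl ⊢; rw [← hkl]; simp)
    · intro h
      exact absurd (Finset.HasAntidiagonal.mem_antidiagonal.2 (by omega)) h

section Tuples

variable {B : Type*} [Ring B] [Algebra ℂ B]

/-- Compositions are the tuples without zero entries. -/
theorem sum_composition_eq_sum_finAntidiagonal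
    (φ : (m : ℕ) → MultilinearMap ℂ (fun _ : Fin m => B) B) (g : ℕ → ℕ → B) (hg : ∀ t, g t 0 = 0)
    (k : ℕ) :
    ∑ κ : Composition k, φ κ.length (fun t => g t (κ.blocksFun t)) =
      ∑ m ∈ Finset.range (k + 1), ∑ x ∈ Finset.finAntidiagonal m k, φ m (fun t => g t (x t)) := by
  rw [Finset.sum_sigma']
  refine Finset.sum_of_injOn (fun κ => List.equivSigmaTuple κ.blocks) ?_ ?_ ?_ ?_
  · intro κ _ κ' _ h
    exact Composition.ext (List.equivSigmaTuple.injective h)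
  · intro κ _
    refine Finset.mem_coe.2 (Finset.mem_sigma.2 ⟨?_, ?_⟩)
    · exact Finset.mem_range.2 (Nat.lt_succ_of_le κ.length_le)
    · exact Finset.mem_finAntidiagonal.2 κ.sum_blocksFun
  · rintro ⟨m, x⟩ hx hnot
    have hx := Finset.mem_finAntidiagonal.1 (Finset.mem_sigma.1 hx).2
    -- Tuples that are not compositions have a zero entry, and there the multilinear map meets a
    -- zero argument.
    by_cases h : ∃ t, x t = 0
    · obtain ⟨t, ht⟩ := h
      exact MultilinearMap.map_coord_zero _ t (by simp only [ht, hg])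
    · refine absurd ?_ hnot
      refine ⟨⟨List.ofFn x, ?_, ?_⟩, Finset.mem_coe.2 (Finset.mem_univ _),
        List.equivSigmaTuple.apply_symm_apply ⟨m, x⟩⟩
      · intro i hi
        obtain ⟨t, rfl⟩ := (List.mem_ofFn' x i).1 hi
        exact Nat.pos_of_ne_zero fun e => h ⟨t, e⟩
      · rw [List.sum_ofFn, hx]
  · intro κ _
    rfl

theorem sum_finAntidiagonal_eq_zero {m k : ℕ} (h : k < m)
    (φ : MultilinearMap ℂ (fun _ : Fin m => B) B) (g : ℕ → ℕ → B) (hg : ∀ t, g t 0 = 0) :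
    ∑ x ∈ Finset.finAntidiagonal m k, φ (fun t => g t (x t)) = 0 := by
  refine Finset.sum_eq_zero fun x hx => ?_
  rw [Finset.mem_finAntidiagonal] at hx
  obtain ⟨t, ht⟩ : ∃ t, x t = 0 := by
    by_contra hne
    have h1 : ∑ _t : Fin m, 1 ≤ ∑ t, x t :=
      Finset.sum_le_sum fun t _ => Nat.one_le_iff_ne_zero.2 fun e => hne ⟨t, e⟩
    simp at h1
    omega
  exact MultilinearMap.map_coord_zero _ t (by simp only [ht, hg])

/-- The formal series `∑ₙ χ_n(b₁, b₂, b₁, …)`. -/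
def MulSeries.altEval (X : MulSeries B) (b₁ b₂ : B) : PowerSeries B :=
  PowerSeries.mk fun d => X.term d (fun t => altSeq b₁ b₂ (0 + t))

/-- The factor I consumes the first b₁, and the sequence that is left begins with b₂; this is the
source of the swapped variables in b₁ G(b₂, b₁). -/
theorem MulSeries.altEval_idSeries_mul (X : MulSeries B) (b₁ b₂ : B) :
    (MulSeries.idSeries * X).altEval b₁ b₂ = PowerSeries.monomial 1 b₁ * X.altEval b₂ b₁ := by
  ext n
  rw [PowerSeries.coeff_monomial_one_mul, MulSeries.altEval, PowerSeries.coeff_mk,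
    MulSeries.idSeries_mul_term, MulSeries.altEval, PowerSeries.coeff_mk]
  simp only [altSeq_add_of_odd b₁ b₂ (p := 0 + 1) rfl]
  rfl

end Tuples

namespace StarProbSpace

variable {B A : Type*} [Ring B] [StarRing B] [Algebra ℂ B] [StarModule ℂ B]
    [Ring A] [StarRing A] [Algebra ℂ A] [StarModule ℂ A] (P : StarProbSpace B A)

theorem word_altSeq (a : A) (i : Fin 2) (b₁ b₂ : B) (e : ℕ) :
    P.word (fun t : Fin (2 * e) => starPair a (altIdx i t)) (fun t => altSeq b₁ b₂ (0 + t)) =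
      (starPair a i * P.incl b₁ * starPair a (i + 1) * P.incl b₂) ^ e := by
  induction e with
  | zero => simp [word_apply]
  | succ e ih =>
    rw [word_apply] at ih ⊢
    rw [pow_succ, ← ih]
    have h : (List.ofFn fun t : Fin (2 * (e + 1)) =>
        starPair a (altIdx i t) * P.incl (altSeq b₁ b₂ (0 + t))) =
        List.ofFn fun t : Fin (2 * e + 1 + 1) =>
          starPair a (altIdx i t) * P.incl (altSeq b₁ b₂ (0 + t)) := rfl
    have h1 : altIdx i (2 * e) = i := altIdx_of_even i (even_two_mul e)
    have h2 : altIdx i (2 * e + 1) = i + 1 := by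
      rw [← altIdx_add_one, altIdx_of_even _ (even_two_mul e)]
    have h3 : altSeq b₁ b₂ (0 + 2 * e) = b₁ := if_pos (by simp)
    have h4 : altSeq b₁ b₂ (0 + (2 * e + 1)) = b₂ := if_neg (by simp)
    rw [h, List.ofFn_succ', List.ofFn_succ', List.concat_eq_append, List.concat_eq_append,
      List.prod_append, List.prod_append, List.prod_singleton, List.prod_singleton]
    simp only [Fin.val_castSucc, Fin.val_last, h1, h2, h3, h4]
    simp only [mul_assoc]

theorem coeff_altEval_momentSeries (a : A) (i : Fin 2) (b₁ b₂ : B) (d : ℕ) :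
    PowerSeries.coeff d ((P.momentSeries a i).altEval b₁ b₂) =
      if Even d then P.E ((starPair a i * P.incl b₁ * starPair a (i + 1) * P.incl b₂) ^ (d / 2))
      else 0 := by
  rw [MulSeries.altEval, PowerSeries.coeff_mk, momentSeries]
  simp only
  split_ifs with h
  · obtain ⟨e, rfl⟩ := even_iff_exists_two_mul.1 h
    rw [Nat.mul_div_cancel_left _ two_pos, ← word_altSeq]
    rfl
  · rfl

theorem seriesF_eq (a : A) (b₁ b₂ : B) :
    P.seriesF a b₁ b₂ = (P.momentSeries a 0).altEval b₁ b₂ := by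
  ext d
  rw [coeff_altEval_momentSeries, seriesF, PowerSeries.coeff_mk]
  rfl

theorem seriesG_eq (a : A) (b₁ b₂ : B) :
    P.seriesG a b₁ b₂ = (P.momentSeries a 1).altEval b₁ b₂ := by
  ext d
  rw [coeff_altEval_momentSeries, seriesG, PowerSeries.coeff_mk]
  rfl

/-- The coefficients of the series substituted for the `t`-th argument. -/
def altArgument (a : A) (i : Fin 2) (b₁ b₂ : B) (t n : ℕ) : B :=
  (MulSeries.idSeries * P.momentSeries a (altIdx (i + 1) t)).term n
    (fun s => altSeq b₁ b₂ (t + s))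

theorem altArgument_zero (a : A) (i : Fin 2) (b₁ b₂ : B) (t : ℕ) :
    P.altArgument a i b₁ b₂ t 0 = 0 :=
  P.idSeries_mul_momentSeries_term _ Even.zero t (altSeq b₁ b₂)

theorem altArgument_of_even (a : A) (i : Fin 2) (b₁ b₂ : B) {t : ℕ} (ht : t % 2 = 0) (n : ℕ) :
    P.altArgument a i b₁ b₂ t n = PowerSeries.coeff n
      (PowerSeries.monomial 1 b₁ * (P.momentSeries a (i + 1)).altEval b₂ b₁) := by
  rw [altArgument, altIdx_of_even _ (Nat.even_iff.2 ht), ← MulSeries.altEval_idSeries_mul,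
    MulSeries.altEval, PowerSeries.coeff_mk]
  simp only [altSeq_add_of_even b₁ b₂ ht]

theorem altArgument_of_odd (a : A) (i : Fin 2) (b₁ b₂ : B) {t : ℕ} (ht : t % 2 = 1) (n : ℕ) :
    P.altArgument a i b₁ b₂ t n = PowerSeries.coeff n
      (PowerSeries.monomial 1 b₂ * (P.momentSeries a i).altEval b₁ b₂) := by
  rw [altArgument, altIdx_add_one, altIdx_of_even _ (Nat.even_iff.2 (by omega)),
    ← MulSeries.altEval_idSeries_mul, MulSeries.altEval, PowerSeries.coeff_mk]
  simp only [altSeq_add_of_odd b₁ b₂ ht]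

theorem coeff_alternatingSubst (a : A) (i : Fin 2) (b₁ b₂ : B) (ℓ d : ℕ) :
    PowerSeries.coeff d ((P.altCumulant a i ℓ).alternatingSubst
      (PowerSeries.monomial 1 b₁ * (P.momentSeries a (i + 1)).altEval b₂ b₁)
      (PowerSeries.monomial 1 b₂ * (P.momentSeries a i).altEval b₁ b₂)) =
    ∑ k ∈ Finset.range (d + 1),
      (∑ x ∈ Finset.finAntidiagonal (2 * ℓ + 1) k, (P.cumulantSeries a i).term (2 * ℓ + 1)
        fun t => P.altArgument a i b₁ b₂ t (x t)) * P.altArgument a i b₁ b₂ 1 (d - k) := by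
  rw [MultilinearMap.alternatingSubst, PowerSeries.coeff_mul,
    Finset.Nat.sum_antidiagonal_eq_sum_range_succ_mk]
  refine Finset.sum_congr rfl fun k _ => ?_
  rw [P.altArgument_of_odd a i b₁ b₂ (t := 1) rfl, MultilinearMap.substSeries, PowerSeries.coeff_mk]
  congr 1
  refine Finset.sum_congr rfl fun x _ => ?_
  rw [cumulantSeries_term_of_odd P a i (odd_two_mul_add_one ℓ), altCumulant]
  congr 1
  funext t
  split_ifs with h
  · exact (P.altArgument_of_even a i b₁ b₂ (Nat.even_iff.1 h) _).symm
  · exact (P.altArgument_of_odd a i b₁ b₂ (Nat.odd_iff.1 (Nat.not_even_iff_odd.1 h)) _).symm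

/-- Each of the 2ℓ + 1 substituted series starts in degree at least one. The bound d < ℓ is crude
but suffices for formal summability. -/
theorem coeff_alternatingSubst_eq_zero (a : A) (i : Fin 2) (b₁ b₂ : B) {ℓ d : ℕ} (h : d < ℓ) :
    PowerSeries.coeff d ((P.altCumulant a i ℓ).alternatingSubst
      (PowerSeries.monomial 1 b₁ * (P.momentSeries a (i + 1)).altEval b₂ b₁)
      (PowerSeries.monomial 1 b₂ * (P.momentSeries a i).altEval b₁ b₂)) = 0 := by
  rw [coeff_alternatingSubst]
  refine Finset.sum_eq_zero fun k hk => ?_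
  rw [Finset.mem_range] at hk
  rw [sum_finAntidiagonal_eq_zero (by omega) _ _ (P.altArgument_zero a i b₁ b₂), zero_mul]

theorem formallySummable_alternatingSubst (a : A) (i : Fin 2) (b₁ b₂ : B) :
    FormallySummable fun ℓ => (P.altCumulant a i ℓ).alternatingSubst
      (PowerSeries.monomial 1 b₁ * (P.momentSeries a (i + 1)).altEval b₂ b₁)
      (PowerSeries.monomial 1 b₂ * (P.momentSeries a i).altEval b₁ b₂) := fun d =>
  (Set.finite_Iic d).subset fun ℓ hℓ => by
    by_contra h
    exact hℓ (P.coeff_alternatingSubst_eq_zero a i b₁ b₂ (not_le.1 h))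

/-- The true starting positions may be replaced by t, and by 1 for the final factor: in every term
that survives, they have the same parity. All other terms are zero on both sides. -/
theorem sum_composition_altSeq (a : A) (i : Fin 2) (b₁ b₂ : B) (k e : ℕ) :
    (∑ κ : Composition k, (P.cumulantSeries a i).term κ.length fun t =>
      (MulSeries.idSeries * P.momentSeries a (altIdx (i + 1) t)).term (κ.blocksFun t)
        fun s => altSeq b₁ b₂ (0 + κ.sizeUpTo t + s)) *
      (MulSeries.idSeries * P.momentSeries a i).term e (fun s => altSeq b₁ b₂ (0 + k + s)) =
    (∑ κ : Composition k, (P.cumulantSeries a i).term κ.length fun t =>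
      P.altArgument a i b₁ b₂ t (κ.blocksFun t)) * P.altArgument a i b₁ b₂ 1 e := by
  rw [Finset.sum_mul, Finset.sum_mul]
  refine Finset.sum_congr rfl fun κ _ => ?_
  by_cases hκ : ∀ t, Odd (κ.blocksFun t)
  · have hpar := fun t ht => Composition.sizeUpTo_mod_two hκ (t := t) ht
    have hlen := hpar κ.length le_rfl
    rw [Composition.sizeUpTo_length] at hlen
    rcases Nat.even_or_odd κ.length with hl | hl
    · rw [cumulantSeries_term_of_even P a i hl, zero_apply, zero_mul, zero_apply, zero_mul]
    · rw [Nat.odd_iff] at hl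
      have hseq : ∀ t t' : ℕ, t % 2 = t' % 2 → ∀ s, altSeq b₁ b₂ (t + s) = altSeq b₁ b₂ (t' + s) := by
        intro t t' h s
        have : Even (t + s) ↔ Even (t' + s) := by
          rw [Nat.even_iff, Nat.even_iff]
          omega
        simp only [altSeq, this]
      have h1 : altIdx (i + 1) 1 = i := by
        rw [altIdx_add_one, altIdx_of_even i (by simp)]
      rw [altArgument, h1]
      simp only [hseq (0 + k) 1 (by omega)]
      congr 2
      funext t
      rw [altArgument]
      simp only [hseq (0 + κ.sizeUpTo t) t (by rw [zero_add, hpar t (by omega)])]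
  · obtain ⟨t, ht⟩ := not_forall.1 hκ
    rw [Nat.not_odd_iff_even] at ht
    rw [MultilinearMap.map_coord_zero _ t, MultilinearMap.map_coord_zero _ t, zero_mul, zero_mul]
    · exact idSeries_mul_momentSeries_term P _ ht t (altSeq b₁ b₂)
    · exact idSeries_mul_momentSeries_term P _ ht _ (altSeq b₁ b₂)

/-- The functional equation of the series `F` (for `i = 0`) and `G` (for `i = 1`). -/
theorem altEval_momentSeries_eq {a : A} (ha : P.IsRDiagonal a) (i : Fin 2) (b₁ b₂ : B) :
    (P.momentSeries a i).altEval b₁ b₂ =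
      1 + formalSum fun ℓ => (P.altCumulant a i ℓ).alternatingSubst
        (PowerSeries.monomial 1 b₁ * (P.momentSeries a (i + 1)).altEval b₂ b₁)
        (PowerSeries.monomial 1 b₂ * (P.momentSeries a i).altEval b₁ b₂) := by
  ext d
  have hsupp : (Function.support fun ℓ => PowerSeries.coeff d
      ((P.altCumulant a i ℓ).alternatingSubst
        (PowerSeries.monomial 1 b₁ * (P.momentSeries a (i + 1)).altEval b₂ b₁)
        (PowerSeries.monomial 1 b₂ * (P.momentSeries a i).altEval b₁ b₂))) ⊆
      (Finset.range (d + 1) : Set ℕ) := by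
    intro ℓ hℓ
    by_contra h
    rw [Finset.coe_range, Set.mem_Iio] at h
    exact hℓ (P.coeff_alternatingSubst_eq_zero a i b₁ b₂ (by omega))
  rw [map_add, formalSum, PowerSeries.coeff_mk, finsum_eq_sum_of_support_subset _ hsupp]
  simp only [coeff_alternatingSubst]
  rw [Finset.sum_comm]
  rw [MulSeries.altEval, PowerSeries.coeff_mk, momentSeries_term_eq P ha]
  congr 1
  · rw [PowerSeries.coeff_one]
    split_ifs with hd
    · subst hd
      rfl
    · rw [MulSeries.one_term_of_pos (Nat.pos_of_ne_zero hd), zero_apply]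
  · refine Finset.sum_congr rfl fun k hk => ?_
    rw [Finset.mem_range] at hk
    rw [sum_composition_altSeq, ← Finset.sum_mul,
      sum_composition_eq_sum_finAntidiagonal (P.cumulantSeries a i).term _
        (P.altArgument_zero a i b₁ b₂)]
    congr 1
    have hz := fun m (h : k < m) => sum_finAntidiagonal_eq_zero h ((P.cumulantSeries a i).term m) _
      (P.altArgument_zero a i b₁ b₂)
    have he : ∀ m, Even m → ∑ x ∈ Finset.finAntidiagonal m k, (P.cumulantSeries a i).term m
        (fun t => P.altArgument a i b₁ b₂ t (x t)) = 0 := fun m hm =>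
      Finset.sum_eq_zero fun x _ => by rw [cumulantSeries_term_of_even P a i hm, zero_apply]
    -- The range of lengths is enlarged by zero terms so as to contain 2ℓ + 1 for every ℓ ≤ d; even
    -- lengths contribute nothing, so the sum can be indexed by ℓ.
    rw [Finset.sum_subset (Finset.range_subset_range.2 (show k + 1 ≤ 2 * d + 2 by omega))
      (fun m _ hm => hz m (by rw [Finset.mem_range] at hm; omega))]
    symm
    refine Finset.sum_of_injOn (fun ℓ => 2 * ℓ + 1) ?_ ?_ ?_ ?_
    · intro ℓ _ ℓ' _ h
      simp only at h
      omega
    · intro ℓ hℓ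
      rw [Finset.coe_range, Set.mem_Iio] at hℓ ⊢
      simp only
      omega
    · intro m hm hnot
      refine he m (Nat.not_odd_iff_even.1 fun ⟨ℓ, hℓ⟩ => hnot ⟨ℓ, ?_, hℓ.symm⟩)
      rw [Finset.mem_range] at hm
      rw [Finset.coe_range, Set.mem_Iio]
      omega
    · intro ℓ _
      rfl

end StarProbSpace

end

theorem mainTheorem5 {B A : Type*} [Ring B] [StarRing B] [Algebra ℂ B] [StarModule ℂ B]
    [Ring A] [StarRing A] [Algebra ℂ A] [StarModule ℂ A] (P : StarProbSpace B A) (a : A)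
    (ha : P.IsRDiagonal a) :
    -- `F = 1 + ∑_ℓ α^{(1)}_ℓ(b₁ G(b₂,b₁), b₂ F(b₁,b₂), …, b₁ G(b₂,b₁)) b₂ F(b₁,b₂)`; each of the
    -- variables `b₁`, `b₂` is of degree one
    (∀ b₁ b₂ : B,
      FormallySummable (fun ℓ => (P.altCumulant a 0 ℓ).alternatingSubst
        (PowerSeries.monomial 1 b₁ * P.seriesG a b₂ b₁)
        (PowerSeries.monomial 1 b₂ * P.seriesF a b₁ b₂)) ∧
      P.seriesF a b₁ b₂ = 1 + formalSum (fun ℓ => (P.altCumulant a 0 ℓ).alternatingSubst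
        (PowerSeries.monomial 1 b₁ * P.seriesG a b₂ b₁)
        (PowerSeries.monomial 1 b₂ * P.seriesF a b₁ b₂))) ∧
    -- `G = 1 + ∑_ℓ α^{(2)}_ℓ(b₁ F(b₂,b₁), b₂ G(b₁,b₂), …, b₁ F(b₂,b₁)) b₂ G(b₁,b₂)`
    (∀ b₁ b₂ : B,
      FormallySummable (fun ℓ => (P.altCumulant a 1 ℓ).alternatingSubst
        (PowerSeries.monomial 1 b₁ * P.seriesF a b₂ b₁)
        (PowerSeries.monomial 1 b₂ * P.seriesG a b₁ b₂)) ∧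
      P.seriesG a b₁ b₂ = 1 + formalSum (fun ℓ => (P.altCumulant a 1 ℓ).alternatingSubst
        (PowerSeries.monomial 1 b₁ * P.seriesF a b₂ b₁)
        (PowerSeries.monomial 1 b₂ * P.seriesG a b₁ b₂))) ∧
    -- the identities of multilinear function series; the `t`-th argument (from `t = 0`) of each term
    -- of the `i`-th cumulant series is replaced by `I M^{(i + 1 + t)}`, upper indices modulo 2
    (∀ i : Fin 2,
      P.momentSeries a i = 1 +
        (P.cumulantSeries a i).comp (fun _ t => altIdx (i + 1) t)
            (fun i' => MulSeries.idSeries * P.momentSeries a i') *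
          (MulSeries.idSeries * P.momentSeries a i)) := by
  refine ⟨fun b₁ b₂ => ?_, fun b₁ b₂ => ?_, P.momentSeries_eq ha⟩
  · rw [P.seriesF_eq, P.seriesG_eq]
    exact ⟨P.formallySummable_alternatingSubst a 0 b₁ b₂, P.altEval_momentSeries_eq ha 0 b₁ b₂⟩
  · rw [P.seriesF_eq, P.seriesG_eq]
    exact ⟨P.formallySummable_alternatingSubst a 1 b₁ b₂, P.altEval_momentSeries_eq ha 1 b₁ b₂⟩
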